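/- Let $s<T$ and let $H=H(x,t,\rho)$, $L=L(x,t,v)$ be real functions on $\mathbb R\times[s,T]\times\mathbb R$ that are Legendre transforms of each other: $$L(x,t,v)=\inf_{p\in\mathbb R}\big(pv+H(x,t,p)\big),\qquad H(x,t,p)=\sup_{v\in\mathbb R}\big(L(x,t,v)-pv\big).$$ Assume that $L$ and $H$ are $C^2$, that $L$ is strictly concave in $v$, and that there are positive constants $c_0,c_1,c_2$ such that, for all $(x,t)\in\mathbb R\times[s,T]$ and $v,\rho\in\mathbb R$, $$-c_0+c_2v^2\le -L(x,t,v)\le c_0+c_1v^2,\qquad -c_0+c_2|v|\le |L_v(x,t,v)|\le c_0+c_1|v|,$$ $$|L_{xv}(x,t,v)|+|L_{xx}(x,t,v)|\le c_1,\qquad |H_x(x,t,\rho)|+|H_{x\rho}(x,t,\rho)|\le c_1 .$$ For $x,y\in\mathbb R$ and $t\in(s,T]$ put $$W(x,t;y,s)=\sup\Big\{\int_s^tL\big(\xi(\theta),\theta,\dot\xi(\theta)\big)\,d\theta:\ \xi\in C^1([s,t];\mathbb R),\ \xi(s)=y,\ \xi(t)=x\Big\},$$ and call a path that attains this supremum a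 maximizing path. Let $M(x,t;y,s)=W_x(x,t;y,s)$, understood as a possibly multi-valued function: its values at $(x,t;y,s)$ are $W_x(x,t;y,s)$, if this derivative exists, and the numbers $L_v(x,t,\dot\xi(t))$, where $\xi$ runs over the maximizing paths for $W(x,t;y,s)$. Then for all $x,y\in\mathbb R$ and $t\in(s,T]$ a maximizing path exists (so $M$ has at least one value), and the following holds. (i) Let $y\in\mathbb R$, $t\in(s,T]$, $x_1<x_2$, and let $\xi_i$ be a maximizing path for $W(x_i,t;y,s)$, $i=1,2$. Then $\xi_1(\theta)<\xi_2(\theta)$ for all $\theta\in(s,t]$. (ii) $M(x,t;y,s)$ is strictly increasing in $y$: if $x\in\mathbb R$, $t\in(s,T]$ and $y_1<y_2$, then every value of $M(x,t;y_1,s)$ is strictly less than every value of $M(x,t;y_2,s)$. (iii) For every $\delta\in(0,1)$ there are positive constants $C_0,C_1$ (depending, for given $L$ and $H$, only on $s,\delta,T$) such that for all $t\in(s,T]$ and all $x,y\in\mathbb R$ with $|x|\ge C_0$ and $|y|\le(1-\delta)|x|$, every value $p$ of $M(x,t;y,s)$ has the same sign as $-x$ and satisfies $|p|\ge C_1|x|$.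 -/

import Mathlib

open Set

namespace FundSol

noncomputable section

/-- Functions of `(x, t, v)` (Lagrangians) or of `(x, t, ρ)` (Hamiltonians), written in curried
form; the middle variable is time. -/
abbrev PhaseFun := ℝ → ℝ → ℝ → ℝ

/-- Partial derivative with respect to the position `x`. -/
def partialX (F : PhaseFun) : PhaseFun := fun x t v => deriv (fun x' => F x' t v) x

/-- Partial derivative with respect to the last variable (velocity, or momentum). -/
def partialV (F : PhaseFun) : PhaseFun := fun x t v => deriv (fun v' => F x t v') v

/-- `F` is of class `C²` on the slab `ℝ × [s, T] × ℝ` (up to the boundary in time). -/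
def IsC2OnSlab (F : PhaseFun) (s T : ℝ) : Prop :=
  ContDiffOn ℝ 2 (fun q : ℝ × ℝ × ℝ => F q.1 q.2.1 q.2.2) (univ ×ˢ (Icc s T ×ˢ univ))

/-- `L` and `H` are Legendre transforms of each other for times in `[s, T]`:
`L(x,t,v) = inf_p (p v + H(x,t,p))` and `H(x,t,p) = sup_v (L(x,t,v) - p v)`. -/
structure IsLegendrePair (L H : PhaseFun) (s T : ℝ) : Prop where
  isGLB_lagrangian : ∀ x, ∀ t ∈ Icc s T, ∀ v,
    IsGLB (range fun p : ℝ => p * v + H x t p) (L x t v)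
  isLUB_hamiltonian : ∀ x, ∀ t ∈ Icc s T, ∀ p,
    IsLUB (range fun v : ℝ => L x t v - p * v) (H x t p)

/-- The standing hypothesis on the Lagrangian `L` and the Hamiltonian `H` for times in `[s, T]`,
with constants `c₀, c₁, c₂`. -/
structure StandingHypothesis (L H : PhaseFun) (s T c₀ c₁ c₂ : ℝ) : Prop where
  c₀_pos : 0 < c₀
  c₁_pos : 0 < c₁
  c₂_pos : 0 < c₂
  legendre : IsLegendrePair L H s T
  lagrangian_C2 : IsC2OnSlab L s T
  hamiltonian_C2 : IsC2OnSlab H s T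
  strictConcave : ∀ x, ∀ t ∈ Icc s T, StrictConcaveOn ℝ univ (fun v => L x t v)
  growth : ∀ x, ∀ t ∈ Icc s T, ∀ v,
    -c₀ + c₂ * v ^ 2 ≤ -L x t v ∧ -L x t v ≤ c₀ + c₁ * v ^ 2
  growth_v : ∀ x, ∀ t ∈ Icc s T, ∀ v,
    -c₀ + c₂ * |v| ≤ |partialV L x t v| ∧ |partialV L x t v| ≤ c₀ + c₁ * |v|
  bound_L : ∀ x, ∀ t ∈ Icc s T, ∀ v,
    |partialV (partialX L) x t v| + |partialX (partialX L) x t v| ≤ c₁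
  bound_H : ∀ x, ∀ t ∈ Icc s T, ∀ ρ,
    |partialX H x t ρ| + |partialV (partialX H) x t ρ| ≤ c₁

/-- `ξ ∈ C¹([s, t]; ℝ)` with `ξ(s) = y` and `ξ(t) = x`.  (Values of `ξ` off `[s, t]` play no
role.) -/
structure IsAdmissiblePath (s y t x : ℝ) (ξ : ℝ → ℝ) : Prop where
  contDiffOn : ContDiffOn ℝ 1 ξ (Icc s t)
  left_eq : ξ s = y
  right_eq : ξ t = x

/-- The velocity of a path on `[s, t]` (one-sided at the end points). -/
def velocity (s t : ℝ) (ξ : ℝ → ℝ) (θ : ℝ) : ℝ := derivWithin ξ (Icc s t) θ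

/-- The action `∫_s^t L(ξ(θ), θ, ξ'(θ)) dθ`. -/
def action (L : PhaseFun) (s t : ℝ) (ξ : ℝ → ℝ) : ℝ :=
  ∫ θ in s..t, L (ξ θ) θ (velocity s t ξ θ)

/-- The fundamental solution `W(x, t; y, s)`: the supremum of the action over admissible paths. -/
def fundW (L : PhaseFun) (x t y s : ℝ) : ℝ :=
  sSup {a : ℝ | ∃ ξ : ℝ → ℝ, IsAdmissiblePath s y t x ξ ∧ a = action L s t ξ}

/-- `ξ` is a maximizing path in the variational problem that defines `W(x, t; y, s)`. -/
def IsMaximizingPath (L : PhaseFun) (s y t x : ℝ) (ξ : ℝ → ℝ) : Prop :=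
  IsAdmissiblePath s y t x ξ ∧ action L s t ξ = fundW L x t y s

/-- The set of values of the (in general multi-valued) function `M(x, t; y, s)`: the derivative
`W_x(x, t; y, s)` whenever it exists, and, for each maximizing path `ξ`, the number
`L_v(x, t, ξ'(t))`. -/
def fundM (L : PhaseFun) (x t y s : ℝ) : Set ℝ :=
  {p : ℝ | HasDerivAt (fun x' => fundW L x' t y s) p x ∨
    ∃ ξ : ℝ → ℝ, IsMaximizingPath L s y t x ξ ∧ p = partialV L x t (velocity s t ξ t)}

end

end FundSol

/-! Existence is the direct method. Paths are encoded by square integrable velocities. Quadratic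
growth bounds a maximizing sequence in L², so a subsequence converges weakly, and concavity in the
velocity makes the action upper semicontinuous (`le_velAction_of_weak`, `exists_isOptimalVelocity`).
By the lemma of du Bois-Reymond, `L_v` along an optimal path agrees a.e. with a primitive `P` of
`L_x`. Duality gives `H_p(x,t,L_v) = -v` and `H_x(x,t,L_v) = L_x`, so the velocity is a.e. the
continuous function `-H_p(X,θ,P)` and `(X,P)` solves the Hamiltonian system
(`exists_isHamiltonianArc`). Hence the L² maximum is attained by a C¹ path and equals `W`
(`fundW_eq`).

Noncrossing is cut and paste. If two optimal paths share an end point and meet at an interior time,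
exchanging their pieces preserves the total action, so the exchanged paths are optimal too. They are
then Hamiltonian arcs that agree with each original path on a subinterval, and ODE uniqueness makes
all of them coincide (`eqOn_of_meet`). Part (i) follows by the intermediate value theorem.

Every value of `M` is the final momentum `P t` of some optimal path: for `L_v` this is regularity,
for `W_x` an envelope argument (`deriv_fundW_eq`). For (ii), paths that end at the same `x` are
ordered before time `t`, which orders the final velocities and, as `L_v` decreases in `v`, the
momenta; equality is excluded by uniqueness. For (iii), at some time the velocity is the mean
velocity `(x - y)/(t - s)`, of size at least a multiple of `|x|`; the momentum there is
correspondingly large with the opposite sign, and it drifts by at most `c₁ (t - s)` up to time `t`.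
-/

namespace FundSol

open MeasureTheory Filter Topology
open scoped NNReal

/-! ### Differentiability of C² functions on the slab -/

/-- The space-time slab on which Lagrangians and Hamiltonians are defined. -/
def slab (s T : ℝ) : Set (ℝ × ℝ × ℝ) := univ ×ˢ (Icc s T ×ˢ univ)

/-- A phase function as a function on the product space. -/
def joint (F : PhaseFun) : ℝ × ℝ × ℝ → ℝ := fun q => F q.1 q.2.1 q.2.2

/-- The differential of a phase function within the slab. -/
noncomputable def slabDeriv (F : PhaseFun) (s T : ℝ) (q : ℝ × ℝ × ℝ) : ℝ × ℝ × ℝ →L[ℝ] ℝ :=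
  fderivWithin ℝ (joint F) (slab s T) q

lemma mem_slab {s T x t v : ℝ} (ht : t ∈ Icc s T) : (x, t, v) ∈ slab s T :=
  ⟨mem_univ _, ht, mem_univ _⟩

lemma uniqueDiffOn_slab {s T : ℝ} (h : s < T) : UniqueDiffOn ℝ (slab s T) :=
  uniqueDiffOn_univ.prod ((uniqueDiffOn_Icc h).prod uniqueDiffOn_univ)

section C2

variable {F : PhaseFun} {s T : ℝ} (hF : IsC2OnSlab F s T)
include hF

lemma IsC2OnSlab.continuousOn_joint : ContinuousOn (joint F) (slab s T) :=
  ContDiffOn.continuousOn hF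

lemma IsC2OnSlab.hasFDerivWithinAt {x t v : ℝ} (ht : t ∈ Icc s T) :
    HasFDerivWithinAt (joint F) (slabDeriv F s T (x, t, v)) (slab s T) (x, t, v) :=
  ((ContDiffOn.differentiableOn hF (by norm_num)) _ (mem_slab ht)).hasFDerivWithinAt

lemma IsC2OnSlab.contDiffOn_slabDeriv (h : s < T) :
    ContDiffOn ℝ 1 (slabDeriv F s T) (slab s T) :=
  ContDiffOn.fderivWithin hF (uniqueDiffOn_slab h) (by norm_num)

/-- At fixed time the map `(x, v) ↦ (x, t, v)` sends the whole plane into the slab, so the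
derivative within the slab restricts to a full derivative in `(x, v)`, even for `t = s` and `t = T`.
-/
lemma IsC2OnSlab.hasFDerivAt_slice {x t v : ℝ} (ht : t ∈ Icc s T) :
    HasFDerivAt (fun q : ℝ × ℝ => F q.1 t q.2)
      (slabDeriv F s T (x, t, v) (1, 0, 0) • ContinuousLinearMap.fst ℝ ℝ ℝ +
        slabDeriv F s T (x, t, v) (0, 0, 1) • ContinuousLinearMap.snd ℝ ℝ ℝ) (x, v) := by
  have h1 : HasFDerivAt (fun q : ℝ × ℝ => ((q.1, t, q.2) : ℝ × ℝ × ℝ))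
      ((ContinuousLinearMap.fst ℝ ℝ ℝ).prod
        ((0 : ℝ × ℝ →L[ℝ] ℝ).prod (ContinuousLinearMap.snd ℝ ℝ ℝ))) (x, v) :=
    hasFDerivAt_fst.prodMk ((hasFDerivAt_const t _).prodMk hasFDerivAt_snd)
  have h2 := (hF.hasFDerivWithinAt (x := x) (v := v) ht).comp (x, v)
    (h1.hasFDerivWithinAt (s := univ)) (fun q _ => mem_slab ht)
  rw [hasFDerivWithinAt_univ] at h2
  refine h2.congr_fderiv ?_
  ext <;> simp

lemma IsC2OnSlab.hasDerivAt_x {x t v : ℝ} (ht : t ∈ Icc s T) :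
    HasDerivAt (fun x => F x t v) (slabDeriv F s T (x, t, v) (1, 0, 0)) x := by
  have h := (hF.hasFDerivAt_slice (x := x) (v := v) ht).comp_hasDerivAt x
    ((hasDerivAt_id x).prodMk (hasDerivAt_const x v))
  simpa [Function.comp_def] using h

lemma IsC2OnSlab.hasDerivAt_v {x t v : ℝ} (ht : t ∈ Icc s T) :
    HasDerivAt (fun v => F x t v) (slabDeriv F s T (x, t, v) (0, 0, 1)) v := by
  have h := (hF.hasFDerivAt_slice (x := x) (v := v) ht).comp_hasDerivAt v
    ((hasDerivAt_const v x).prodMk (hasDerivAt_id v))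
  simpa [Function.comp_def] using h

lemma IsC2OnSlab.partialX_eq {x t v : ℝ} (ht : t ∈ Icc s T) :
    partialX F x t v = slabDeriv F s T (x, t, v) (1, 0, 0) := (hF.hasDerivAt_x ht).deriv

lemma IsC2OnSlab.partialV_eq {x t v : ℝ} (ht : t ∈ Icc s T) :
    partialV F x t v = slabDeriv F s T (x, t, v) (0, 0, 1) := (hF.hasDerivAt_v ht).deriv

lemma IsC2OnSlab.continuousOn_partialX (h : s < T) :
    ContinuousOn (joint (partialX F)) (slab s T) := by
  refine ((hF.contDiffOn_slabDeriv h).continuousOn.clm_apply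
    (continuousOn_const (c := ((1, 0, 0) : ℝ × ℝ × ℝ)))).congr fun q hq => ?_
  exact hF.partialX_eq hq.2.1

lemma IsC2OnSlab.continuousOn_partialV (h : s < T) :
    ContinuousOn (joint (partialV F)) (slab s T) := by
  refine ((hF.contDiffOn_slabDeriv h).continuousOn.clm_apply
    (continuousOn_const (c := ((0, 0, 1) : ℝ × ℝ × ℝ)))).congr fun q hq => ?_
  exact hF.partialV_eq hq.2.1

/-- The differential is C¹, so its own derivative is bounded on a compact convex box that contains
all times at once; this makes the constant independent of `t`. Applied to `H`, it is the local
Lipschitz bound for the Hamiltonian vector field. -/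
lemma IsC2OnSlab.exists_lipschitzOnWith (h : s < T) (R : ℝ) :
    ∃ K : ℝ≥0, ∀ t ∈ Icc s T, LipschitzOnWith K
      (fun z : ℝ × ℝ => (-partialV F z.1 t z.2, partialX F z.1 t z.2))
      (Icc (-R) R ×ˢ Icc (-R) R) := by
  set B : Set (ℝ × ℝ × ℝ) := Icc (-R) R ×ˢ (Icc s T ×ˢ Icc (-R) R) with hB
  have hBc : IsCompact B := isCompact_Icc.prod (isCompact_Icc.prod isCompact_Icc)
  have hBconv : Convex ℝ B := (convex_Icc _ _).prod ((convex_Icc _ _).prod (convex_Icc _ _))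
  have hBs : B ⊆ slab s T := fun q hq => ⟨mem_univ _, hq.2.1, mem_univ _⟩
  have hG := hF.contDiffOn_slabDeriv h
  have hG' : ContinuousOn (fderivWithin ℝ (slabDeriv F s T) (slab s T)) (slab s T) :=
    hG.continuousOn_fderivWithin (uniqueDiffOn_slab h) le_rfl
  obtain ⟨C, hC⟩ := hBc.exists_bound_of_continuousOn
    (E := ℝ × ℝ × ℝ →L[ℝ] ℝ × ℝ × ℝ →L[ℝ] ℝ) (hG'.mono hBs)
  have hlip : LipschitzOnWith C.toNNReal (slabDeriv F s T) B := by
    refine hBconv.lipschitzOnWith_of_nnnorm_hasFDerivWithin_le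
      (fun q hq => (((hG.differentiableOn (by norm_num)) q
        (hBs hq)).hasFDerivWithinAt).mono hBs) fun q hq => ?_
    rw [← NNReal.coe_le_coe, coe_nnnorm]
    exact (hC q hq).trans (Real.le_coe_toNNReal C)
  refine ⟨C.toNNReal, fun t ht => LipschitzOnWith.of_dist_le_mul fun z hz w hw => ?_⟩
  have key := hlip.dist_le_mul (z.1, t, z.2) ⟨hz.1, ht, hz.2⟩ (w.1, t, w.2) ⟨hw.1, ht, hw.2⟩
  have hd : dist ((z.1, t, z.2) : ℝ × ℝ × ℝ) (w.1, t, w.2) = dist z w := by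
    simp [Prod.dist_eq]
  rw [hd, dist_eq_norm] at key
  have hunit : ∀ e : ℝ × ℝ × ℝ, ‖e‖ ≤ 1 →
      dist (slabDeriv F s T (z.1, t, z.2) e) (slabDeriv F s T (w.1, t, w.2) e)
        ≤ C.toNNReal * dist z w := fun e he => by
    rw [dist_eq_norm, ← _root_.sub_apply]
    refine (ContinuousLinearMap.le_opNorm _ _).trans ?_
    exact (mul_le_of_le_one_right (norm_nonneg _) he).trans key
  rw [Prod.dist_eq]
  refine max_le ?_ ?_
  · simp only [dist_neg_neg, hF.partialV_eq ht]
    exact hunit _ (by simp [Prod.norm_def])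
  · simp only [hF.partialX_eq ht]
    exact hunit _ (by simp [Prod.norm_def])

end C2

/-! ### Legendre duality and extension to all times -/

/-- A Lagrangian `L` with its first derivatives and those of its Hamiltonian, defined for all
times, with the bounds and the duality relations that the variational problem needs. -/
structure IsTonelli (L Lx Lv Hx Hp : PhaseFun) (c₀ c₁ c₂ : ℝ) : Prop where
  c₀_pos : 0 < c₀
  c₁_pos : 0 < c₁
  c₂_pos : 0 < c₂
  continuous_L : Continuous (joint L)
  continuous_Lx : Continuous (joint Lx)
  continuous_Lv : Continuous (joint Lv)
  continuous_Hx : Continuous (joint Hx)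
  continuous_Hp : Continuous (joint Hp)
  hasFDerivAt : ∀ x t v, HasFDerivAt (fun q : ℝ × ℝ => L q.1 t q.2)
    (Lx x t v • ContinuousLinearMap.fst ℝ ℝ ℝ + Lv x t v • ContinuousLinearMap.snd ℝ ℝ ℝ) (x, v)
  upper : ∀ x t v, L x t v ≤ c₀ - c₂ * v ^ 2
  lower : ∀ x t v, -(c₀ + c₁ * v ^ 2) ≤ L x t v
  abs_Lx_le : ∀ x t v, |Lx x t v| ≤ c₁
  abs_Lv_le : ∀ x t v, |Lv x t v| ≤ c₀ + c₁ * |v|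
  tangent : ∀ x t v w, L x t w ≤ L x t v + Lv x t v * (w - v)
  strictAnti : ∀ x t, StrictAnti (Lv x t)
  Hp_Lv : ∀ x t v, Hp x t (Lv x t v) = -v
  Hx_Lv : ∀ x t v, Hx x t (Lv x t v) = Lx x t v
  lipschitz : ∀ R : ℝ, ∃ K : ℝ≥0, ∀ t, LipschitzOnWith K
    (fun z : ℝ × ℝ => (-Hp z.1 t z.2, Hx z.1 t z.2)) (Icc (-R) R ×ˢ Icc (-R) R)

/-- The function that agrees with `F` for times in `[s, T]` and is constant in time outside. -/
noncomputable def clampTime (F : PhaseFun) {s T : ℝ} (h : s ≤ T) : PhaseFun :=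
  fun x t v => F x (projIcc s T h t) v

lemma clampTime_of_mem (F : PhaseFun) {s T : ℝ} (h : s ≤ T) {x t v : ℝ} (ht : t ∈ Icc s T) :
    clampTime F h x t v = F x t v := by
  simp [clampTime, projIcc_of_mem h ht]

lemma continuous_clampTime {F : PhaseFun} {s T : ℝ} (h : s ≤ T)
    (hF : ContinuousOn (joint F) (slab s T)) : Continuous (joint (clampTime F h)) := by
  have : Continuous fun q : ℝ × ℝ × ℝ => ((q.1, (projIcc s T h q.2.1 : ℝ), q.2.2) : ℝ × ℝ × ℝ) :=
    by fun_prop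
  exact hF.comp_continuous this fun q => mem_slab (projIcc s T h q.2.1).2

section Standing

variable {L H : PhaseFun} {s T c₀ c₁ c₂ : ℝ} (hyp : StandingHypothesis L H s T c₀ c₁ c₂)
include hyp

lemma StandingHypothesis.hasDerivAt_v {x t v : ℝ} (ht : t ∈ Icc s T) :
    HasDerivAt (fun v => L x t v) (partialV L x t v) v := by
  rw [hyp.lagrangian_C2.partialV_eq ht]
  exact hyp.lagrangian_C2.hasDerivAt_v ht

lemma StandingHypothesis.strictAnti_partialV {x t : ℝ} (ht : t ∈ Icc s T) :
    StrictAnti (partialV L x t) := by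
  have h := (hyp.strictConcave x t ht).neg
  have hd : ∀ v, HasDerivAt (-fun v => L x t v) (-partialV L x t v) v :=
    fun v => (hyp.hasDerivAt_v ht).neg
  intro v w hvw
  have h1 := h.lt_slope_of_hasDerivAt (mem_univ v) (mem_univ w) hvw (hd v)
  have h2 := h.slope_lt_of_hasDerivAt (mem_univ v) (mem_univ w) hvw (hd w)
  linarith

lemma StandingHypothesis.tangent {x t : ℝ} (ht : t ∈ Icc s T) (v w : ℝ) :
    L x t w ≤ L x t v + partialV L x t v * (w - v) := by
  have h := (hyp.strictConcave x t ht).concaveOn.neg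
  have hd : ∀ v, HasDerivAt (-fun v => L x t v) (-partialV L x t v) v :=
    fun v => (hyp.hasDerivAt_v ht).neg
  rcases lt_trichotomy v w with hvw | rfl | hvw
  · have h1 := h.le_slope_of_hasDerivAt (mem_univ v) (mem_univ w) hvw (hd v)
    rw [slope_def_field, le_div_iff₀ (sub_pos.2 hvw)] at h1
    simp only [Pi.neg_apply] at h1
    linarith
  · simp
  · have h1 := h.slope_le_of_hasDerivAt (mem_univ w) (mem_univ v) hvw (hd v)
    rw [slope_def_field, div_le_iff₀ (sub_pos.2 hvw)] at h1
    simp only [Pi.neg_apply] at h1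
    linarith

/-- By the tangent inequality the supremum that defines `H` at the slope `L_v(x,t,v)` is attained at
`v`. -/
lemma StandingHypothesis.hamiltonian_partialV {x t : ℝ} (ht : t ∈ Icc s T) (v : ℝ) :
    H x t (partialV L x t v) = L x t v - partialV L x t v * v := by
  refine (hyp.legendre.isLUB_hamiltonian x t ht _).unique ⟨?_, fun b hb => hb ⟨v, rfl⟩⟩
  rintro _ ⟨w, rfl⟩
  have := hyp.tangent (x := x) ht v w
  simp only
  linarith

lemma StandingHypothesis.partialV_hamiltonian {x t : ℝ} (ht : t ∈ Icc s T) (v : ℝ) :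
    partialV H x t (partialV L x t v) = -v := by
  have hd := (hyp.hamiltonian_C2.hasDerivAt_v (x := x) (v := partialV L x t v) ht)
  rw [← hyp.hamiltonian_C2.partialV_eq ht] at hd
  -- Duality gives `H(x,t,p) + p v ≥ L(x,t,v)` for all `p`, with equality at `p = L_v`.
  have hmin : IsLocalMin (fun p => H x t p + p * v) (partialV L x t v) := by
    refine Eventually.of_forall fun p => ?_
    have h1 := (hyp.legendre.isLUB_hamiltonian x t ht p).1 ⟨v, rfl⟩
    have h2 := hyp.hamiltonian_partialV (x := x) ht v
    simp only at h1 ⊢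
    linarith
  have := hmin.hasDerivAt_eq_zero (hd.add ((hasDerivAt_id _).mul_const v))
  linarith

lemma StandingHypothesis.partialX_hamiltonian {x t : ℝ} (ht : t ∈ Icc s T) (v : ℝ) :
    partialX H x t (partialV L x t v) = partialX L x t v := by
  set p := partialV L x t v with hp
  have hd := (hyp.hamiltonian_C2.hasDerivAt_x (x := x) (v := p) ht)
  rw [← hyp.hamiltonian_C2.partialX_eq ht] at hd
  have hl := (hyp.lagrangian_C2.hasDerivAt_x (x := x) (v := v) ht)
  rw [← hyp.lagrangian_C2.partialX_eq ht] at hl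
  -- With `p` and `v` frozen, `H(x',t,p) - L(x',t,v) ≥ -p v`, with equality at `x' = x`.
  have hmin : IsLocalMin (fun x' => H x' t p - L x' t v) x := by
    refine Eventually.of_forall fun x' => ?_
    have h1 := (hyp.legendre.isLUB_hamiltonian x' t ht p).1 ⟨v, rfl⟩
    have h2 := hyp.hamiltonian_partialV (x := x) ht v
    simp only at h1 ⊢
    rw [← hp] at h2
    linarith
  have := hmin.hasDerivAt_eq_zero (hd.sub hl)
  linarith

/-- Freezing time outside `[s, T]` keeps every bound, since each holds time by time, and turns
continuity on the slab into joint continuity on the whole space. -/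
theorem StandingHypothesis.isTonelli (h : s < T) :
    IsTonelli (clampTime L h.le) (clampTime (partialX L) h.le) (clampTime (partialV L) h.le)
      (clampTime (partialX H) h.le) (clampTime (partialV H) h.le) c₀ c₁ c₂ where
  c₀_pos := hyp.c₀_pos
  c₁_pos := hyp.c₁_pos
  c₂_pos := hyp.c₂_pos
  continuous_L := continuous_clampTime h.le hyp.lagrangian_C2.continuousOn_joint
  continuous_Lx := continuous_clampTime h.le (hyp.lagrangian_C2.continuousOn_partialX h)
  continuous_Lv := continuous_clampTime h.le (hyp.lagrangian_C2.continuousOn_partialV h)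
  continuous_Hx := continuous_clampTime h.le (hyp.hamiltonian_C2.continuousOn_partialX h)
  continuous_Hp := continuous_clampTime h.le (hyp.hamiltonian_C2.continuousOn_partialV h)
  hasFDerivAt x t v := by
    have ht := (projIcc s T h.le t).2
    have := hyp.lagrangian_C2.hasFDerivAt_slice (x := x) (v := v) ht
    rwa [← hyp.lagrangian_C2.partialX_eq ht, ← hyp.lagrangian_C2.partialV_eq ht] at this
  upper x t v := by
    have := (hyp.growth x _ (projIcc s T h.le t).2 v).1
    simp only [clampTime]
    linarith
  lower x t v := by
    have := (hyp.growth x _ (projIcc s T h.le t).2 v).2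
    simp only [clampTime]
    linarith
  abs_Lx_le x t v := by
    have ht := (projIcc s T h.le t).2
    -- The bound on `L_x` is the one on `H_x`, read at the dual momentum.
    have h1 := hyp.bound_H x _ ht (partialV L x (projIcc s T h.le t) v)
    rw [hyp.partialX_hamiltonian ht] at h1
    exact (le_add_of_nonneg_right (abs_nonneg _)).trans h1
  abs_Lv_le x t v := (hyp.growth_v x _ (projIcc s T h.le t).2 v).2
  tangent x t v w := hyp.tangent (projIcc s T h.le t).2 v w
  strictAnti x t := hyp.strictAnti_partialV (projIcc s T h.le t).2
  Hp_Lv x t v := hyp.partialV_hamiltonian (projIcc s T h.le t).2 v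
  Hx_Lv x t v := hyp.partialX_hamiltonian (projIcc s T h.le t).2 v
  lipschitz R := by
    obtain ⟨K, hK⟩ := hyp.hamiltonian_C2.exists_lipschitzOnWith h R
    exact ⟨K, fun t => hK _ (projIcc s T h.le t).2⟩

end Standing

/-! ### Weak sequential compactness in L² -/

section SquareIntegrable

variable {α : Type*} [MeasurableSpace α] {μ : Measure α}

lemma inner_toLp {f g : α → ℝ} (hf : MemLp f 2 μ) (hg : MemLp g 2 μ) :
    inner ℝ (hf.toLp f) (hg.toLp g) = ∫ a, f a * g a ∂μ := by
  rw [L2.inner_def]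
  refine integral_congr_ae ?_
  filter_upwards [hf.coeFn_toLp, hg.coeFn_toLp] with a h1 h2
  simp [h1, h2, mul_comm]

lemma norm_toLp_sq {f : α → ℝ} (hf : MemLp f 2 μ) : ‖hf.toLp f‖ ^ 2 = ∫ a, f a ^ 2 ∂μ := by
  rw [← real_inner_self_eq_norm_sq, inner_toLp]
  simp_rw [sq]

lemma abs_integral_mul_le {f g : α → ℝ} (hf : MemLp f 2 μ) (hg : MemLp g 2 μ) :
    |∫ a, f a * g a ∂μ| ≤ √(∫ a, f a ^ 2 ∂μ) * √(∫ a, g a ^ 2 ∂μ) := by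
  rw [← inner_toLp hf hg, ← norm_toLp_sq hf, ← norm_toLp_sq hg, Real.sqrt_sq (norm_nonneg _),
    Real.sqrt_sq (norm_nonneg _)]
  exact abs_real_inner_le_norm _ _

/-- Riesz identifies L² with its dual, where closed balls are weak-* sequentially compact because L²
is separable. -/
lemma exists_weak_limit [SigmaFinite μ] [IsSeparable μ] {u : ℕ → α → ℝ} {C : ℝ}
    (hu : ∀ n, MemLp (u n) 2 μ) (hC : ∀ n, ∫ a, u n a ^ 2 ∂μ ≤ C) :
    ∃ φ : ℕ → ℕ, StrictMono φ ∧ ∃ v, MemLp v 2 μ ∧ ∀ g, MemLp g 2 μ →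
      Tendsto (fun n => ∫ a, u (φ n) a * g a ∂μ) atTop (𝓝 (∫ a, v a * g a ∂μ)) := by
  have : Fact ((2 : ENNReal) ≠ ⊤) := ⟨by norm_num⟩
  let J := InnerProductSpace.toDual ℝ (Lp ℝ 2 μ)
  let f : ℕ → WeakDual ℝ (Lp ℝ 2 μ) := fun n => StrongDual.toWeakDual (J ((hu n).toLp (u n)))
  have hmem : ∀ n, f n ∈ WeakDual.toStrongDual ⁻¹' Metric.closedBall 0 (√C) := fun n => by
    have : ‖J ((hu n).toLp (u n))‖ ≤ √C := by
      rw [LinearIsometryEquiv.norm_map]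
      refine Real.le_sqrt_of_sq_le ?_
      rw [norm_toLp_sq]
      exact hC n
    simpa [f] using this
  obtain ⟨g, -, φ, hφ, hlim⟩ := WeakDual.isSeqCompact_closedBall ℝ (Lp ℝ 2 μ) 0 (√C) hmem
  let v := J.symm (WeakDual.toStrongDual g)
  refine ⟨φ, hφ, v, Lp.memLp v, fun h hh => ?_⟩
  have h1 := ((WeakDual.eval_continuous (hh.toLp h)).tendsto g).comp hlim
  have h2 : g (hh.toLp h) = ∫ a, v a * h a ∂μ := by
    have : g (hh.toLp h) = J v (hh.toLp h) := by simp [v]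
    rw [this, InnerProductSpace.toDual_apply_apply, ← inner_toLp (Lp.memLp v) hh, Lp.toLp_coeFn]
  rw [h2] at h1
  refine h1.congr fun n => ?_
  rw [← inner_toLp (hu _) hh]
  rfl

end SquareIntegrable

/-! ### Paths described by their velocities -/

/-- The path that starts at `y` at time `s` and has velocity `u`. -/
noncomputable def pathOf (s y : ℝ) (u : ℝ → ℝ) (θ : ℝ) : ℝ := y + ∫ r in s..θ, u r

/-- The action of the path with velocity `u`. -/
noncomputable def velAction (L : PhaseFun) (s t y : ℝ) (u : ℝ → ℝ) : ℝ :=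
  ∫ θ in s..t, L (pathOf s y u θ) θ (u θ)

/-- Square integrable velocities that carry `y` at time `s` to `x` at time `t`. -/
structure IsVelocity (s t y x : ℝ) (u : ℝ → ℝ) : Prop where
  memLp : MemLp u 2 (volume.restrict (Ioc s t))
  integral_eq : ∫ r in s..t, u r = x - y

/-- Velocities of maximal action among the square integrable ones. -/
structure IsOptimalVelocity (L : PhaseFun) (s t y x : ℝ) (u : ℝ → ℝ) : Prop
    extends IsVelocity s t y x u where
  le_action : ∀ w, IsVelocity s t y x w → velAction L s t y w ≤ velAction L s t y u

section Paths

variable {s t y x : ℝ} {u w : ℝ → ℝ}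

lemma intervalIntegrable_of_memLp (hst : s ≤ t) (hu : MemLp u 2 (volume.restrict (Ioc s t))) :
    IntervalIntegrable u volume s t :=
  (intervalIntegrable_iff_integrableOn_Ioc_of_le hst).2 (hu.integrable one_le_two)

lemma continuousOn_pathOf (hst : s ≤ t) (hu : IntervalIntegrable u volume s t) :
    ContinuousOn (pathOf s y u) (Icc s t) := by
  have := intervalIntegral.continuousOn_primitive_interval'
    (hu.mono_set le_rfl) (left_mem_uIcc)
  rw [uIcc_of_le hst] at this
  exact continuousOn_const.add this

lemma aestronglyMeasurable_of_continuousOn_Icc {f : ℝ → ℝ} (hf : ContinuousOn f (Icc s t)) :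
    AEStronglyMeasurable f (volume.restrict (Ioc s t)) :=
  (hf.mono Ioc_subset_Icc_self).aestronglyMeasurable measurableSet_Ioc

lemma pathOf_add_mul (hst : s ≤ t) (hu : IntervalIntegrable u volume s t)
    (hw : IntervalIntegrable w volume s t) (ε : ℝ) {θ : ℝ} (hθ : θ ∈ Icc s t) :
    pathOf s y (fun r => u r + ε * w r) θ = pathOf s y u θ + ε * pathOf s 0 w θ := by
  have hsub : uIcc s θ ⊆ uIcc s t := by
    rw [uIcc_of_le hθ.1, uIcc_of_le hst]; exact Icc_subset_Icc_right hθ.2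
  simp only [pathOf]
  rw [intervalIntegral.integral_add (hu.mono_set hsub) ((hw.mono_set hsub).const_mul ε),
    intervalIntegral.integral_const_mul]
  ring

end Paths

/-! ### First variation and existence of optimal velocities -/

namespace IsTonelli

variable {L Lx Lv Hx Hp : PhaseFun} {c₀ c₁ c₂ : ℝ} (D : IsTonelli L Lx Lv Hx Hp c₀ c₁ c₂)
include D

lemma abs_L_le (x t v : ℝ) : |L x t v| ≤ c₀ + c₁ * v ^ 2 := by
  have h1 := D.upper x t v
  have h2 := D.lower x t v
  have h3 := mul_nonneg D.c₂_pos.le (sq_nonneg v)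
  have h4 := mul_nonneg D.c₁_pos.le (sq_nonneg v)
  exact abs_le.2 ⟨by linarith, by linarith⟩

variable {s t y x : ℝ} {X u w η : ℝ → ℝ}

omit D in
lemma _root_.FundSol.aestronglyMeasurable_joint {F : PhaseFun} (hF : Continuous (joint F))
    {μ : Measure ℝ} (hX : AEStronglyMeasurable X μ) (hu : AEStronglyMeasurable u μ) :
    AEStronglyMeasurable (fun θ => F (X θ) θ (u θ)) μ :=
  hF.comp_aestronglyMeasurable (hX.prodMk (aestronglyMeasurable_id.prodMk hu))

omit D in
lemma integrable_bound {μ : Measure ℝ} [IsFiniteMeasure μ] (hu : MemLp u 2 μ) :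
    Integrable (fun θ => c₀ + c₁ * u θ ^ 2) μ :=
  (integrable_const c₀).add (hu.integrable_sq.const_mul c₁)

omit D in
lemma memLp_bound {μ : Measure ℝ} [IsFiniteMeasure μ] (hu : MemLp u 2 μ) :
    MemLp (fun θ => c₀ + c₁ * |u θ|) 2 μ :=
  (memLp_const c₀).add (hu.norm.const_mul c₁)

lemma integrable_L {μ : Measure ℝ} [IsFiniteMeasure μ] (hX : AEStronglyMeasurable X μ)
    (hu : MemLp u 2 μ) : Integrable (fun θ => L (X θ) θ (u θ)) μ :=
  (integrable_bound hu).mono' (aestronglyMeasurable_joint D.continuous_L hX hu.1)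
    (Eventually.of_forall fun _ => D.abs_L_le _ _ _)

lemma memLp_Lv {μ : Measure ℝ} [IsFiniteMeasure μ] (hX : AEStronglyMeasurable X μ)
    (hu : MemLp u 2 μ) : MemLp (fun θ => Lv (X θ) θ (u θ)) 2 μ :=
  (memLp_bound hu).mono' (aestronglyMeasurable_joint D.continuous_Lv hX hu.1)
    (Eventually.of_forall fun _ => D.abs_Lv_le _ _ _)

lemma hasDerivAt_line (a b e f θ ε : ℝ) :
    HasDerivAt (fun ε => L (a + ε * b) θ (e + ε * f))
      (Lx (a + ε * b) θ (e + ε * f) * b + Lv (a + ε * b) θ (e + ε * f) * f) ε := by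
  have h1 : HasDerivAt (fun ε => a + ε * b) b ε := by
    simpa using ((hasDerivAt_id ε).mul_const b).const_add a
  have h2 : HasDerivAt (fun ε => e + ε * f) f ε := by
    simpa using ((hasDerivAt_id ε).mul_const f).const_add e
  simpa [Function.comp_def] using
    (D.hasFDerivAt (a + ε * b) θ (e + ε * f)).comp_hasDerivAt ε (h1.prodMk h2)

/-- Differentiation under the integral: for `|ε| ≤ 1` the integrand's derivative is dominated by a
constant plus a product of two L² functions, thanks to the linear growth of `L_v` and the bounds on
`L_x` and `η`. -/
lemma hasDerivAt_integral {μ : Measure ℝ} [IsFiniteMeasure μ] {C : ℝ}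
    (hX : AEStronglyMeasurable X μ) (hη : AEStronglyMeasurable η μ)
    (hC : ∀ᵐ θ ∂μ, |η θ| ≤ C) (hu : MemLp u 2 μ) (hw : MemLp w 2 μ) :
    HasDerivAt (fun ε => ∫ θ, L (X θ + ε * η θ) θ (u θ + ε * w θ) ∂μ)
      (∫ θ, (Lx (X θ) θ (u θ) * η θ + Lv (X θ) θ (u θ) * w θ) ∂μ) 0 := by
  have hXε : ∀ ε : ℝ, AEStronglyMeasurable (fun θ => X θ + ε * η θ) μ :=
    fun ε => hX.add (hη.const_mul ε)
  have huε : ∀ ε : ℝ, MemLp (fun θ => u θ + ε * w θ) 2 μ := fun ε => hu.add (hw.const_mul ε)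
  have hbound : Integrable (fun θ => c₁ * C + (c₀ + c₁ * (|u θ| + |w θ|)) * |w θ|) μ := by
    refine (integrable_const _).add (MemLp.integrable_mul (p := 2) (q := 2) ?_ hw.norm)
    exact (memLp_const c₀).add ((hu.norm.add hw.norm).const_mul c₁)
  have h := hasDerivAt_integral_of_dominated_loc_of_deriv_le (μ := μ) (x₀ := (0 : ℝ))
    (F := fun ε θ => L (X θ + ε * η θ) θ (u θ + ε * w θ))
    (F' := fun ε θ => Lx (X θ + ε * η θ) θ (u θ + ε * w θ) * η θ
      + Lv (X θ + ε * η θ) θ (u θ + ε * w θ) * w θ)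
    (Metric.ball_mem_nhds (0 : ℝ) one_pos)
    (Eventually.of_forall fun ε => (D.integrable_L (hXε ε) (huε ε)).1)
    (D.integrable_L (hXε 0) (huε 0))
    (((aestronglyMeasurable_joint D.continuous_Lx (hXε 0) (huε 0).1).mul hη).add
      ((aestronglyMeasurable_joint D.continuous_Lv (hXε 0) (huε 0).1).mul hw.1))
    (by
      filter_upwards [hC] with θ hθ ε hε
      have hε' : |ε| ≤ 1 := by simpa using (Metric.mem_ball.1 hε).le
      rw [Real.norm_eq_abs]
      refine (abs_add_le _ _).trans (add_le_add ?_ ?_)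
      · rw [abs_mul]
        exact mul_le_mul (D.abs_Lx_le _ _ _) hθ (abs_nonneg _) D.c₁_pos.le
      · rw [abs_mul]
        refine mul_le_mul_of_nonneg_right ((D.abs_Lv_le _ _ _).trans ?_) (abs_nonneg _)
        have h1 : |u θ + ε * w θ| ≤ |u θ| + |w θ| := by
          refine (abs_add_le _ _).trans (add_le_add le_rfl ?_)
          rw [abs_mul]
          exact mul_le_of_le_one_left (abs_nonneg _) hε'
        have := mul_le_mul_of_nonneg_left h1 D.c₁_pos.le
        linarith)
    hbound
    (Eventually.of_forall fun θ ε _ => D.hasDerivAt_line _ _ _ _ _ _)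
  simpa using h.2

lemma hasDerivAt_velAction (hst : s ≤ t) (hu : MemLp u 2 (volume.restrict (Ioc s t)))
    (hw : MemLp w 2 (volume.restrict (Ioc s t))) :
    HasDerivAt (fun ε => velAction L s t y (fun r => u r + ε * w r))
      (∫ θ in s..t, (Lx (pathOf s y u θ) θ (u θ) * pathOf s 0 w θ
        + Lv (pathOf s y u θ) θ (u θ) * w θ)) 0 := by
  have hui := intervalIntegrable_of_memLp hst hu
  have hwi := intervalIntegrable_of_memLp hst hw
  have hηc := continuousOn_pathOf (y := 0) hst hwi
  obtain ⟨C, hC⟩ := isCompact_Icc.exists_bound_of_continuousOn hηc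
  rw [intervalIntegral.integral_of_le hst]
  have hae : ∀ᵐ θ ∂(volume.restrict (Ioc s t)), |pathOf s 0 w θ| ≤ C := by
    filter_upwards [ae_restrict_mem measurableSet_Ioc] with θ hθ
    exact hC θ (Ioc_subset_Icc_self hθ)
  refine (D.hasDerivAt_integral (aestronglyMeasurable_of_continuousOn_Icc
    (continuousOn_pathOf (y := y) hst hui)) (aestronglyMeasurable_of_continuousOn_Icc hηc)
    hae hu hw).congr_of_eventuallyEq (Eventually.of_forall fun ε => ?_)
  simp only [velAction, intervalIntegral.integral_of_le hst]
  refine setIntegral_congr_fun measurableSet_Ioc fun θ hθ => ?_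
  rw [pathOf_add_mul hst hui hwi ε (Ioc_subset_Icc_self hθ)]

lemma velAction_le (hst : s ≤ t) (hu : MemLp u 2 (volume.restrict (Ioc s t))) :
    velAction L s t y u ≤ c₀ * (t - s) - c₂ * ∫ θ in Ioc s t, u θ ^ 2 := by
  rw [velAction, intervalIntegral.integral_of_le hst]
  have h1 : ∫ θ in Ioc s t, (c₀ - c₂ * u θ ^ 2)
      = c₀ * (t - s) - c₂ * ∫ θ in Ioc s t, u θ ^ 2 := by
    rw [integral_sub (integrable_const _) (hu.integrable_sq.const_mul _), integral_const_mul]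
    simp [hst, mul_comm]
  rw [← h1]
  exact integral_mono (D.integrable_L (aestronglyMeasurable_of_continuousOn_Icc
    (continuousOn_pathOf hst (intervalIntegrable_of_memLp hst hu))) hu)
    ((integrable_const _).sub (hu.integrable_sq.const_mul _)) fun θ => D.upper _ _ _

lemma velAction_le' (hst : s ≤ t) (hu : MemLp u 2 (volume.restrict (Ioc s t))) :
    velAction L s t y u ≤ c₀ * (t - s) := by
  have h1 := D.velAction_le (y := y) hst hu
  have h2 : 0 ≤ ∫ θ in Ioc s t, u θ ^ 2 := integral_nonneg fun _ => sq_nonneg _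
  have := mul_nonneg D.c₂_pos.le h2
  linarith

/-- The action is upper semicontinuous under weak convergence of velocities. -/
lemma le_velAction_of_weak {U : ℕ → ℝ → ℝ} {S B : ℝ} (hst : s ≤ t)
    (hU : ∀ n, MemLp (U n) 2 (volume.restrict (Ioc s t)))
    (hu : MemLp u 2 (volume.restrict (Ioc s t)))
    (hB : ∀ n, ∫ θ in Ioc s t, U n θ ^ 2 ≤ B)
    (hweak : ∀ g, MemLp g 2 (volume.restrict (Ioc s t)) →
      Tendsto (fun n => ∫ θ in Ioc s t, U n θ * g θ) atTop (𝓝 (∫ θ in Ioc s t, u θ * g θ)))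
    (hS : Tendsto (fun n => velAction L s t y (U n)) atTop (𝓝 S)) :
    S ≤ velAction L s t y u := by
  set μ := volume.restrict (Ioc s t) with hμ
  set X := pathOf s y u with hXdef
  set Xn := fun n => pathOf s y (U n) with hXndef
  have hX : AEStronglyMeasurable X μ := aestronglyMeasurable_of_continuousOn_Icc
    (continuousOn_pathOf hst (intervalIntegrable_of_memLp hst hu))
  have hXn : ∀ n, AEStronglyMeasurable (Xn n) μ := fun n => aestronglyMeasurable_of_continuousOn_Icc
    (continuousOn_pathOf hst (intervalIntegrable_of_memLp hst (hU n)))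
  -- Testing weak convergence against the indicator of `(s, θ]` gives pointwise convergence of the
  -- paths.
  have hconv : ∀ θ ∈ Ioc s t, Tendsto (fun n => Xn n θ) atTop (𝓝 (X θ)) := fun θ hθ => by
    have hg : MemLp (indicator (Ioc s θ) fun _ => (1 : ℝ)) 2 μ :=
      (memLp_const (1 : ℝ)).indicator measurableSet_Ioc
    have key : ∀ v : ℝ → ℝ, ∫ r, v r * indicator (Ioc s θ) (fun _ => (1 : ℝ)) r ∂μ
        = ∫ r in s..θ, v r := fun v => by
      rw [intervalIntegral.integral_of_le hθ.1.le]
      have : (fun r => v r * indicator (Ioc s θ) (fun _ => (1 : ℝ)) r)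
          = indicator (Ioc s θ) v := by
        ext r; by_cases hr : r ∈ Ioc s θ <;> simp [hr]
      rw [this, hμ, setIntegral_indicator measurableSet_Ioc,
        inter_eq_right.2 (Ioc_subset_Ioc_right hθ.2)]
    have h := hweak _ hg
    simp only [key] at h
    exact h.const_add y
  have hae : ∀ᵐ θ ∂μ, Tendsto (fun n => Xn n θ) atTop (𝓝 (X θ)) := by
    filter_upwards [ae_restrict_mem measurableSet_Ioc] with θ hθ using hconv θ hθ
  have hcont : ∀ {F : PhaseFun}, Continuous (joint F) → ∀ θ v, Continuous fun x => F x θ v :=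
    fun hF θ v => hF.comp (by fun_prop : Continuous fun x : ℝ => ((x, θ, v) : ℝ × ℝ × ℝ))
  have h1 : Tendsto (fun n => ∫ θ, L (Xn n θ) θ (u θ) ∂μ) atTop
      (𝓝 (∫ θ, L (X θ) θ (u θ) ∂μ)) := by
    refine tendsto_integral_of_dominated_convergence (fun θ => c₀ + c₁ * u θ ^ 2)
      (fun n => (D.integrable_L (hXn n) hu).1) (integrable_bound hu)
      (fun n => Eventually.of_forall fun θ => D.abs_L_le _ _ _) ?_
    filter_upwards [hae] with θ hθ
    exact ((hcont D.continuous_L θ (u θ)).tendsto _).comp hθ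
  -- In the tangent bound `L(Xn, Un) ≤ L(Xn, u) + L_v(Xn, u) (Un - u)` the slope is split as `d n`
  -- plus `L_v(X, u)`. The first part tends to 0 strongly and meets a bounded factor; the second is
  -- fixed in L², so weak convergence applies.
  set d : ℕ → ℝ → ℝ := fun n θ => Lv (Xn n θ) θ (u θ) - Lv (X θ) θ (u θ) with hd
  have hdL : ∀ n, MemLp (d n) 2 μ := fun n => (D.memLp_Lv (hXn n) hu).sub (D.memLp_Lv hX hu)
  have h2 : Tendsto (fun n => ∫ θ, d n θ ^ 2 ∂μ) atTop (𝓝 0) := by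
    have : Tendsto (fun n => ∫ θ, d n θ ^ 2 ∂μ) atTop (𝓝 (∫ _, (0 : ℝ) ∂μ)) := by
      refine tendsto_integral_of_dominated_convergence
        (fun θ => (2 * (c₀ + c₁ * |u θ|)) ^ 2) (fun n => (hdL n).integrable_sq.1)
        ((memLp_bound hu).const_mul 2).integrable_sq
        (fun n => Eventually.of_forall fun θ => ?_) ?_
      · rw [Real.norm_eq_abs, abs_pow]
        refine pow_le_pow_left₀ (abs_nonneg _) ((abs_sub _ _).trans ?_) 2
        have e1 := D.abs_Lv_le (Xn n θ) θ (u θ)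
        have e2 := D.abs_Lv_le (X θ) θ (u θ)
        linarith
      · filter_upwards [hae] with θ hθ
        have := (((hcont D.continuous_Lv θ (u θ)).tendsto _).comp hθ).sub_const (Lv (X θ) θ (u θ))
        simpa using this.pow 2
    simpa using this
  set B' := √B + √(∫ θ, u θ ^ 2 ∂μ) with hB'
  have h3 : Tendsto (fun n => ∫ θ, d n θ * (U n θ - u θ) ∂μ) atTop (𝓝 0) := by
    refine squeeze_zero_norm (a := fun n => √(∫ θ, d n θ ^ 2 ∂μ) * B') (fun n => ?_) ?_
    · refine (abs_integral_mul_le (hdL n) ((hU n).sub hu)).trans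
        (mul_le_mul_of_nonneg_left ?_ (Real.sqrt_nonneg _))
      have e := norm_sub_le ((hU n).toLp (U n)) (hu.toLp u)
      rw [← MemLp.toLp_sub, ← Real.sqrt_sq (norm_nonneg (MemLp.toLp _ _)), norm_toLp_sq,
        ← Real.sqrt_sq (norm_nonneg ((hU n).toLp (U n))), norm_toLp_sq,
        ← Real.sqrt_sq (norm_nonneg (hu.toLp u)), norm_toLp_sq] at e
      exact e.trans (add_le_add (Real.sqrt_le_sqrt (hB n)) le_rfl)
    · have := (h2.sqrt).mul_const B'
      simpa using this
  have h4 : Tendsto (fun n => ∫ θ, U n θ * Lv (X θ) θ (u θ) ∂μ - ∫ θ, u θ * Lv (X θ) θ (u θ) ∂μ)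
      atTop (𝓝 0) := by
    simpa using (hweak _ (D.memLp_Lv hX hu)).sub_const (∫ θ, u θ * Lv (X θ) θ (u θ) ∂μ)
  have hlim := (h1.add h3).add h4
  have hA : velAction L s t y u = ∫ θ, L (X θ) θ (u θ) ∂μ := by
    rw [velAction, intervalIntegral.integral_of_le hst]
  rw [hA]
  refine le_of_tendsto_of_tendsto' hS (by simpa using hlim) fun n => ?_
  rw [velAction, intervalIntegral.integral_of_le hst]
  have i1 := D.integrable_L (hXn n) hu
  have i2 : Integrable (fun θ => d n θ * (U n θ - u θ)) μ :=
    MemLp.integrable_mul (p := 2) (q := 2) (hdL n) ((hU n).sub hu)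
  have i3 : Integrable (fun θ => U n θ * Lv (X θ) θ (u θ)) μ :=
    MemLp.integrable_mul (p := 2) (q := 2) (hU n) (D.memLp_Lv hX hu)
  have i4 : Integrable (fun θ => u θ * Lv (X θ) θ (u θ)) μ :=
    MemLp.integrable_mul (p := 2) (q := 2) hu (D.memLp_Lv hX hu)
  have i12 : Integrable (fun θ => L (Xn n θ) θ (u θ) + d n θ * (U n θ - u θ)) μ := i1.add i2
  have i34 : Integrable
      (fun θ => U n θ * Lv (X θ) θ (u θ) - u θ * Lv (X θ) θ (u θ)) μ := i3.sub i4
  rw [← integral_sub i3 i4, ← integral_add i1 i2, ← integral_add i12 i34]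
  refine integral_mono (D.integrable_L (hXn n) (hU n)) (i12.add i34) fun θ => ?_
  have := D.tangent (Xn n θ) θ (u θ) (U n θ)
  simp only [hd]
  linarith

/-- Tonelli's existence theorem in the class of square integrable velocities. -/
theorem exists_isOptimalVelocity (hst : s < t) (y x : ℝ) :
    ∃ u, IsOptimalVelocity L s t y x u := by
  set A : Set ℝ := {a | ∃ u, IsVelocity s t y x u ∧ a = velAction L s t y u} with hA
  have hne : A.Nonempty := by
    refine ⟨_, fun _ => (x - y) / (t - s), ⟨memLp_const _, ?_⟩, rfl⟩
    rw [intervalIntegral.integral_const, smul_eq_mul, mul_div_cancel₀ _ (sub_pos.2 hst).ne']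
  have hbdd : BddAbove A := by
    refine ⟨c₀ * (t - s), ?_⟩
    rintro _ ⟨u, hu, rfl⟩
    exact D.velAction_le' hst.le hu.memLp
  obtain ⟨a, -, ha, hamem⟩ := exists_seq_tendsto_sSup hne hbdd
  choose U hU haU using hamem
  obtain ⟨m, hm⟩ := ha.bddBelow_range
  -- Coercivity: actions bounded below by `m` force bounded L² norms.
  have hB : ∀ n, ∫ θ in Ioc s t, U n θ ^ 2 ≤ (c₀ * (t - s) - m) / c₂ := fun n => by
    rw [le_div_iff₀ D.c₂_pos]
    have h1 := D.velAction_le (y := y) hst.le (hU n).memLp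
    have h2 := hm ⟨n, rfl⟩
    rw [haU n] at h2
    linarith
  obtain ⟨φ, hφ, u, hu, hweak⟩ := exists_weak_limit (fun n => (hU n).memLp) hB
  -- The end point condition passes to the weak limit by testing against the constant 1.
  have hint : ∫ r in s..t, u r = x - y := by
    have h := hweak (fun _ => 1) (memLp_const 1)
    simp only [mul_one] at h
    rw [intervalIntegral.integral_of_le hst.le]
    refine tendsto_nhds_unique h (tendsto_const_nhds.congr fun n => ?_)
    rw [← (hU (φ n)).integral_eq, intervalIntegral.integral_of_le hst.le]
  refine ⟨u, ⟨⟨hu, hint⟩, fun w hw => (le_csSup hbdd ⟨w, hw, rfl⟩).trans ?_⟩⟩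
  refine D.le_velAction_of_weak hst.le (fun n => (hU (φ n)).memLp) hu (fun n => hB _) hweak ?_
  simpa only [Function.comp_def, haU] using ha.comp hφ.tendsto_atTop

end IsTonelli

/-! ### Du Bois-Reymond and regularity of optimal paths -/

lemma ae_restrict_Ioc_eq_deriv_primitive {f : ℝ → ℝ} {s t : ℝ} (hst : s ≤ t)
    (hf : IntervalIntegrable f volume s t) :
    ∀ᵐ θ ∂(volume.restrict (Ioc s t)), deriv (fun θ => ∫ r in s..θ, f r) θ = f θ := by
  rw [ae_restrict_iff' measurableSet_Ioc]
  filter_upwards [hf.ae_hasDerivAt_integral] with θ h hθ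
  exact (h (by rw [uIcc_of_le hst]; exact Ioc_subset_Icc_self hθ) s left_mem_uIcc).deriv

/-- Integration by parts for two primitives. -/
lemma integral_mul_primitive {f w : ℝ → ℝ} {s t : ℝ} (hst : s ≤ t)
    (hf : IntervalIntegrable f volume s t) (hw : IntervalIntegrable w volume s t) :
    ∫ θ in s..t, f θ * ∫ r in s..θ, w r =
      (∫ θ in s..t, f θ) * (∫ θ in s..t, w θ) - ∫ θ in s..t, (∫ r in s..θ, f r) * w θ := by
  have h := (hf.absolutelyContinuousOnInterval_intervalIntegral
    left_mem_uIcc).integral_mul_deriv_eq_deriv_mul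
    (hw.absolutelyContinuousOnInterval_intervalIntegral left_mem_uIcc)
  have h1 : ∫ θ in s..t, deriv (fun θ => ∫ r in s..θ, f r) θ * ∫ r in s..θ, w r
      = ∫ θ in s..t, f θ * ∫ r in s..θ, w r := by
    rw [intervalIntegral.integral_of_le hst, intervalIntegral.integral_of_le hst]
    refine integral_congr_ae ?_
    filter_upwards [ae_restrict_Ioc_eq_deriv_primitive hst hf] with θ hθ
    rw [hθ]
  have h2 : ∫ θ in s..t, (∫ r in s..θ, f r) * deriv (fun θ => ∫ r in s..θ, w r) θ
      = ∫ θ in s..t, (∫ r in s..θ, f r) * w θ := by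
    rw [intervalIntegral.integral_of_le hst, intervalIntegral.integral_of_le hst]
    refine integral_congr_ae ?_
    filter_upwards [ae_restrict_Ioc_eq_deriv_primitive hst hw] with θ hθ
    rw [hθ]
  rw [h1, h2] at h
  simp only [intervalIntegral.integral_same, mul_zero, sub_zero] at h
  linarith

/-- The lemma of du Bois-Reymond for square integrable functions. -/
lemma exists_ae_eq_const {g : ℝ → ℝ} {s t : ℝ} (hst : s < t)
    (hg : MemLp g 2 (volume.restrict (Ioc s t)))
    (h : ∀ w, MemLp w 2 (volume.restrict (Ioc s t)) → ∫ θ in s..t, w θ = 0 →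
      ∫ θ in s..t, g θ * w θ = 0) :
    ∃ m : ℝ, ∀ᵐ θ ∂(volume.restrict (Ioc s t)), g θ = m := by
  have hgi := intervalIntegrable_of_memLp hst.le hg
  set m := (∫ θ in s..t, g θ) / (t - s) with hm
  -- The test function is `g` minus its mean; orthogonality then says that its L² norm vanishes.
  have hw : MemLp (fun θ => g θ - m) 2 (volume.restrict (Ioc s t)) := hg.sub (memLp_const m)
  have hwi := intervalIntegrable_of_memLp hst.le hw
  have h0 : ∫ θ in s..t, (g θ - m) = 0 := by
    rw [intervalIntegral.integral_sub hgi (by simp), intervalIntegral.integral_const, smul_eq_mul,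
      hm, mul_div_cancel₀ _ (sub_pos.2 hst).ne', sub_self]
  have h1 := h _ hw h0
  have hgw : IntervalIntegrable (fun θ => g θ * (g θ - m)) volume s t :=
    (intervalIntegrable_iff_integrableOn_Ioc_of_le hst.le).2
      (MemLp.integrable_mul (p := 2) (q := 2) hg hw)
  have h2 : ∫ θ in Ioc s t, (g θ - m) ^ 2 = 0 := by
    rw [← intervalIntegral.integral_of_le hst.le]
    calc ∫ θ in s..t, (g θ - m) ^ 2 = ∫ θ in s..t, (g θ * (g θ - m) - m * (g θ - m)) := by
          congr 1; ext θ; ring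
      _ = 0 := by
          rw [intervalIntegral.integral_sub hgw (hwi.const_mul m), h1,
            intervalIntegral.integral_const_mul, h0]
          simp
  rw [integral_eq_zero_iff_of_nonneg (fun θ => sq_nonneg _) hw.integrable_sq] at h2
  refine ⟨m, ?_⟩
  filter_upwards [h2] with θ hθ
  have : g θ - m = 0 := by simpa using hθ
  linarith

lemma pathOf_congr_ae {s t y : ℝ} {u v : ℝ → ℝ} (h : ∀ᵐ θ ∂(volume.restrict (Ioc s t)), u θ = v θ)
    {θ : ℝ} (hθ : θ ∈ Icc s t) : pathOf s y u θ = pathOf s y v θ := by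
  simp only [pathOf, intervalIntegral.integral_of_le hθ.1]
  congr 1
  exact integral_congr_ae (ae_restrict_of_ae_restrict_of_subset (Ioc_subset_Ioc_right hθ.2) h)

lemma exists_continuous_extension {f : ℝ → ℝ} {s t : ℝ} (hst : s ≤ t)
    (hf : ContinuousOn f (Icc s t)) : ∃ g : ℝ → ℝ, Continuous g ∧ ∀ θ ∈ Icc s t, g θ = f θ :=
  ⟨IccExtend hst ((Icc s t).domRestrict f), (continuousOn_iff_continuous_domRestrict.1 hf).Icc_extend',
    fun _ hθ => IccExtend_of_mem hst _ hθ⟩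

lemma hasDerivAt_pathOf {s y : ℝ} {u : ℝ → ℝ} (hu : Continuous u) (θ : ℝ) :
    HasDerivAt (pathOf s y u) (u θ) θ :=
  (hu.integral_hasStrictDerivAt s θ).hasDerivAt.const_add y

/-- A solution `(X, P)` of the Hamiltonian system on `[s, t]`, with `P` the momentum of `X`. -/
structure IsHamiltonianArc (Lv Hx Hp : PhaseFun) (s t : ℝ) (X P : ℝ → ℝ) : Prop where
  hasDerivAt_fst : ∀ θ ∈ Icc s t, HasDerivAt X (-Hp (X θ) θ (P θ)) θ
  hasDerivAt_snd : ∀ θ ∈ Icc s t, HasDerivAt P (Hx (X θ) θ (P θ)) θ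
  momentum : ∀ θ ∈ Icc s t, P θ = Lv (X θ) θ (-Hp (X θ) θ (P θ))

namespace IsTonelli

variable {L Lx Lv Hx Hp : PhaseFun} {c₀ c₁ c₂ : ℝ} (D : IsTonelli L Lx Lv Hx Hp c₀ c₁ c₂)
variable {s t y x : ℝ} {u w : ℝ → ℝ}

lemma _root_.FundSol.IsVelocity.add_mul {z : ℝ} (hst : s ≤ t) (hu : IsVelocity s t y x u)
    (hw : MemLp w 2 (volume.restrict (Ioc s t))) (hwz : ∫ θ in s..t, w θ = z) (ε : ℝ) :
    IsVelocity s t y (x + ε * z) (fun r => u r + ε * w r) where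
  memLp := hu.memLp.add (hw.const_mul ε)
  integral_eq := by
    rw [intervalIntegral.integral_add (intervalIntegrable_of_memLp hst hu.memLp)
      ((intervalIntegrable_of_memLp hst hw).const_mul ε), intervalIntegral.integral_const_mul,
      hu.integral_eq, hwz]
    ring

include D

lemma firstVariation_eq_zero (hst : s ≤ t) (hu : IsOptimalVelocity L s t y x u)
    (hw : MemLp w 2 (volume.restrict (Ioc s t))) (hw0 : ∫ θ in s..t, w θ = 0) :
    ∫ θ in s..t, (Lx (pathOf s y u θ) θ (u θ) * pathOf s 0 w θ
        + Lv (pathOf s y u θ) θ (u θ) * w θ) = 0 := by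
  refine IsLocalMax.hasDerivAt_eq_zero (Eventually.of_forall fun ε => ?_)
    (D.hasDerivAt_velAction hst hu.memLp hw)
  have h := hu.le_action _ (by simpa using hu.toIsVelocity.add_mul hst hw hw0 ε)
  simpa using h

/-- Regularity: an optimal velocity agrees almost everywhere with the velocity of a solution of the
Hamiltonian system. -/
theorem exists_isHamiltonianArc (hst : s < t) (hu : IsOptimalVelocity L s t y x u) :
    ∃ X P, IsHamiltonianArc Lv Hx Hp s t X P ∧ (∀ θ ∈ Icc s t, X θ = pathOf s y u θ) ∧
      ∀ᵐ θ ∂(volume.restrict (Ioc s t)), u θ = -Hp (X θ) θ (P θ) := by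
  have hui := intervalIntegrable_of_memLp hst.le hu.memLp
  set X₀ := pathOf s y u with hX₀
  have hX₀c : ContinuousOn X₀ (Icc s t) := continuousOn_pathOf hst.le hui
  have hX₀m := aestronglyMeasurable_of_continuousOn_Icc hX₀c
  set f : ℝ → ℝ := fun θ => Lx (X₀ θ) θ (u θ) with hf
  set g : ℝ → ℝ := fun θ => Lv (X₀ θ) θ (u θ) with hg
  have hfL : MemLp f 2 (volume.restrict (Ioc s t)) := (memLp_const c₁).mono'
    (aestronglyMeasurable_joint D.continuous_Lx hX₀m hu.memLp.1)
    (Eventually.of_forall fun _ => D.abs_Lx_le _ _ _)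
  have hfi := intervalIntegrable_of_memLp hst.le hfL
  have hgL : MemLp g 2 (volume.restrict (Ioc s t)) := D.memLp_Lv hX₀m hu.memLp
  have hFc : ∀ m, ContinuousOn (pathOf s m f) (Icc s t) := fun m => continuousOn_pathOf hst.le hfi
  have hFL : MemLp (pathOf s 0 f) 2 (volume.restrict (Ioc s t)) := by
    obtain ⟨C, hC⟩ := isCompact_Icc.exists_bound_of_continuousOn (hFc 0)
    refine (memLp_const C).mono' (aestronglyMeasurable_of_continuousOn_Icc (hFc 0)) ?_
    filter_upwards [ae_restrict_mem measurableSet_Ioc] with θ hθ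
    exact hC θ (Ioc_subset_Icc_self hθ)
  -- Integrating by parts moves the `L_x` term onto `w`, so the first variation becomes the integral
  -- of (`g` minus a primitive of `f`) times `w`; that difference is therefore a.e. a constant `m`,
  -- the initial momentum.
  obtain ⟨m, hm⟩ := exists_ae_eq_const hst (hgL.sub hFL) fun w hw hw0 => by
    have hwi := intervalIntegrable_of_memLp hst.le hw
    have h1 := D.firstVariation_eq_zero hst.le hu hw hw0
    have h2 := integral_mul_primitive hst.le hfi hwi
    have i1 : IntervalIntegrable (fun θ => f θ * pathOf s 0 w θ) volume s t :=
      hfi.mul_continuousOn (by rw [uIcc_of_le hst.le]; exact continuousOn_pathOf hst.le hwi)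
    have i2 : IntervalIntegrable (fun θ => g θ * w θ) volume s t :=
      (intervalIntegrable_iff_integrableOn_Ioc_of_le hst.le).2
        (MemLp.integrable_mul (p := 2) (q := 2) hgL hw)
    have i3 : IntervalIntegrable (fun θ => pathOf s 0 f θ * w θ) volume s t :=
      hwi.continuousOn_mul (by rw [uIcc_of_le hst.le]; exact hFc 0)
    rw [intervalIntegral.integral_add i1 i2] at h1
    rw [hw0, mul_zero, zero_sub] at h2
    have e1 : ∫ θ in s..t, f θ * pathOf s 0 w θ = ∫ θ in s..t, f θ * ∫ r in s..θ, w r := by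
      simp [pathOf]
    have e2 : ∫ θ in s..t, pathOf s 0 f θ * w θ = ∫ θ in s..t, (∫ r in s..θ, f r) * w θ := by
      simp [pathOf]
    simp only [Pi.sub_apply, sub_mul]
    rw [intervalIntegral.integral_sub i2 i3, e2]
    linarith
  set P₀ := pathOf s m f with hP₀
  have hgP : ∀ᵐ θ ∂(volume.restrict (Ioc s t)), g θ = P₀ θ := by
    filter_upwards [hm] with θ hθ
    simp only [Pi.sub_apply] at hθ
    simp only [hP₀, pathOf] at hθ ⊢
    linarith
  have hcomp : ∀ {F : PhaseFun}, Continuous (joint F) → ∀ {a b : ℝ → ℝ},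
      ContinuousOn a (Icc s t) → ContinuousOn b (Icc s t) →
      ContinuousOn (fun θ => F (a θ) θ (b θ)) (Icc s t) := fun hF _ _ ha hb =>
    hF.comp_continuousOn (ha.prodMk (continuousOn_id.prodMk hb))
  have hVc : ContinuousOn (fun θ => -Hp (X₀ θ) θ (P₀ θ)) (Icc s t) :=
    (hcomp D.continuous_Hp hX₀c (hFc m)).neg
  -- The right-hand sides are extended continuously beyond `[s, t]`, so that their primitives have
  -- two-sided derivatives at the end points as well.
  obtain ⟨V, hV, hVeq⟩ := exists_continuous_extension hst.le hVc
  obtain ⟨Q, hQ, hQeq⟩ := exists_continuous_extension hst.le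
    (f := fun θ => Hx (X₀ θ) θ (P₀ θ)) (hcomp D.continuous_Hx hX₀c (hFc m))
  have huV : ∀ᵐ θ ∂(volume.restrict (Ioc s t)), u θ = V θ := by
    filter_upwards [hgP, ae_restrict_mem measurableSet_Ioc] with θ h1 hθ
    rw [hVeq θ (Ioc_subset_Icc_self hθ), ← h1, hg]
    simp [D.Hp_Lv]
  have hfQ : ∀ᵐ θ ∂(volume.restrict (Ioc s t)), f θ = Q θ := by
    filter_upwards [hgP, ae_restrict_mem measurableSet_Ioc] with θ h1 hθ
    rw [hQeq θ (Ioc_subset_Icc_self hθ), ← h1, hg, hf]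
    simp [D.Hx_Lv]
  have hX : ∀ θ ∈ Icc s t, pathOf s y V θ = X₀ θ := fun θ hθ => (pathOf_congr_ae huV hθ).symm
  have hP : ∀ θ ∈ Icc s t, pathOf s m Q θ = P₀ θ := fun θ hθ => (pathOf_congr_ae hfQ hθ).symm
  -- Both sides are continuous, so the a.e. identity holds everywhere on `[s, t]`, in particular at
  -- the final time, where `M` is read off.
  have hLvV : EqOn (fun θ => Lv (X₀ θ) θ (V θ)) P₀ (Icc s t) := by
    refine Measure.eqOn_Icc_of_ae_eq volume hst.ne ?_
      (hcomp D.continuous_Lv hX₀c hV.continuousOn) (hFc m)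
    rw [restrict_Ioc_eq_restrict_Icc.symm]
    filter_upwards [hgP, huV] with θ h1 h2
    rw [← h1, ← h2]
  refine ⟨pathOf s y V, pathOf s m Q, ⟨fun θ hθ => ?_, fun θ hθ => ?_, fun θ hθ => ?_⟩, hX, ?_⟩
  · rw [hX θ hθ, hP θ hθ, ← hVeq θ hθ]
    exact hasDerivAt_pathOf hV θ
  · rw [hX θ hθ, hP θ hθ, ← hQeq θ hθ]
    exact hasDerivAt_pathOf hQ θ
  · rw [hX θ hθ, hP θ hθ, ← hVeq θ hθ]
    exact (hLvV hθ).symm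
  · filter_upwards [huV, ae_restrict_mem measurableSet_Ioc] with θ h1 hθ
    have hθ' := Ioc_subset_Icc_self hθ
    rw [h1, hX θ hθ', hP θ hθ', ← hVeq θ hθ']

end IsTonelli

/-! ### From optimal velocities to C¹ maximizing paths -/

section Bridge

variable {L : PhaseFun} {s t y x : ℝ} {ξ ζ : ℝ → ℝ}

lemma velocity_congr (h : EqOn ξ ζ (Icc s t)) {θ : ℝ} (hθ : θ ∈ Icc s t) :
    velocity s t ξ θ = velocity s t ζ θ := derivWithin_congr h (h hθ)

lemma IsAdmissiblePath.continuousOn_velocity (hst : s < t) (h : IsAdmissiblePath s y t x ξ) :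
    ContinuousOn (velocity s t ξ) (Icc s t) :=
  h.contDiffOn.continuousOn_derivWithin (uniqueDiffOn_Icc hst) le_rfl

lemma IsAdmissiblePath.pathOf_velocity (hst : s < t) (h : IsAdmissiblePath s y t x ξ) {θ : ℝ}
    (hθ : θ ∈ Icc s t) : pathOf s y (velocity s t ξ) θ = ξ θ := by
  have hsub : Icc s θ ⊆ Icc s t := Icc_subset_Icc_right hθ.2
  have hc := h.continuousOn_velocity hst
  have hi : IntervalIntegrable (velocity s t ξ) volume s θ :=
    ContinuousOn.intervalIntegrable (by rw [uIcc_of_le hθ.1]; exact hc.mono hsub)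
  have := intervalIntegral.integral_eq_sub_of_hasDerivAt_of_le hθ.1
    (h.contDiffOn.continuousOn.mono hsub) (fun r hr => ?_) hi
  · rw [pathOf, this, h.left_eq]; ring
  · have hr' : r ∈ Ioo s t := ⟨hr.1, hr.2.trans_le hθ.2⟩
    exact ((h.contDiffOn.differentiableOn (by norm_num)) r
      (Ioo_subset_Icc_self hr')).hasDerivWithinAt.hasDerivAt (Icc_mem_nhds hr'.1 hr'.2)

lemma IsAdmissiblePath.isVelocity (hst : s < t) (h : IsAdmissiblePath s y t x ξ) :
    IsVelocity s t y x (velocity s t ξ) where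
  memLp := by
    have hc := h.continuousOn_velocity hst
    obtain ⟨C, hC⟩ := isCompact_Icc.exists_bound_of_continuousOn hc
    refine (memLp_const C).mono' (aestronglyMeasurable_of_continuousOn_Icc hc) ?_
    filter_upwards [ae_restrict_mem measurableSet_Ioc] with θ hθ
    exact hC θ (Ioc_subset_Icc_self hθ)
  integral_eq := by
    have := h.pathOf_velocity hst (right_mem_Icc.2 hst.le)
    rw [pathOf, h.right_eq] at this
    linarith

lemma IsAdmissiblePath.action_eq (hst : s < t) (h : IsAdmissiblePath s y t x ξ) :
    action L s t ξ = velAction L s t y (velocity s t ξ) := by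
  refine intervalIntegral.integral_congr fun θ hθ => ?_
  rw [uIcc_of_le hst.le] at hθ
  simp only [h.pathOf_velocity hst hθ]

lemma pathOf_left {u : ℝ → ℝ} : pathOf s y u s = y := by simp [pathOf]

lemma IsVelocity.pathOf_right {u : ℝ → ℝ} (hu : IsVelocity s t y x u) : pathOf s y u t = x := by
  rw [pathOf, hu.integral_eq]; ring

end Bridge

namespace IsHamiltonianArc

variable {Lv Hx Hp : PhaseFun} {s t : ℝ} {X P Y Q : ℝ → ℝ}

lemma continuousOn_fst (h : IsHamiltonianArc Lv Hx Hp s t X P) : ContinuousOn X (Icc s t) :=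
  fun θ hθ => (h.hasDerivAt_fst θ hθ).continuousAt.continuousWithinAt

lemma continuousOn_snd (h : IsHamiltonianArc Lv Hx Hp s t X P) : ContinuousOn P (Icc s t) :=
  fun θ hθ => (h.hasDerivAt_snd θ hθ).continuousAt.continuousWithinAt

lemma velocity_eq (h : IsHamiltonianArc Lv Hx Hp s t X P) (hst : s < t) {θ : ℝ}
    (hθ : θ ∈ Icc s t) : velocity s t X θ = -Hp (X θ) θ (P θ) :=
  (h.hasDerivAt_fst θ hθ).hasDerivWithinAt.derivWithin (uniqueDiffOn_Icc hst θ hθ)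

lemma momentum_eq (h : IsHamiltonianArc Lv Hx Hp s t X P) (hst : s < t) {θ : ℝ}
    (hθ : θ ∈ Icc s t) : P θ = Lv (X θ) θ (velocity s t X θ) := by
  rw [h.velocity_eq hst hθ, ← h.momentum θ hθ]

end IsHamiltonianArc

namespace IsTonelli

variable {L Lx Lv Hx Hp : PhaseFun} {c₀ c₁ c₂ : ℝ} (D : IsTonelli L Lx Lv Hx Hp c₀ c₁ c₂)
variable {s t y x : ℝ} {u w X P Y Q ξ : ℝ → ℝ}
include D

lemma isAdmissiblePath_of_arc (hst : s < t) (h : IsHamiltonianArc Lv Hx Hp s t X P) :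
    IsAdmissiblePath s (X s) t (X t) X where
  contDiffOn := by
    rw [contDiffOn_one_iff_derivWithin (uniqueDiffOn_Icc hst)]
    refine ⟨fun θ hθ => (h.hasDerivAt_fst θ hθ).differentiableAt.differentiableWithinAt, ?_⟩
    have : ContinuousOn (fun θ => -Hp (X θ) θ (P θ)) (Icc s t) :=
      (D.continuous_Hp.comp_continuousOn
        (h.continuousOn_fst.prodMk (continuousOn_id.prodMk h.continuousOn_snd))).neg
    exact this.congr fun θ hθ => h.velocity_eq hst hθ
  left_eq := rfl
  right_eq := rfl

/-- Two solutions of the Hamiltonian system that agree at one time have the same path. -/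
lemma eqOn_of_eq_at (h₁ : IsHamiltonianArc Lv Hx Hp s t X P)
    (h₂ : IsHamiltonianArc Lv Hx Hp s t Y Q) {τ : ℝ} (hτ : τ ∈ Icc s t) (hX : X τ = Y τ)
    (hP : P τ = Q τ) : EqOn X Y (Icc s t) := by
  -- The vector field is only locally Lipschitz, so both arcs are first confined to a common box.
  obtain ⟨R, hR⟩ : ∃ R, ∀ θ ∈ Icc s t, |X θ| ≤ R ∧ |P θ| ≤ R ∧ |Y θ| ≤ R ∧ |Q θ| ≤ R := by
    obtain ⟨R₁, h1⟩ := isCompact_Icc.exists_bound_of_continuousOn h₁.continuousOn_fst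
    obtain ⟨R₂, h2⟩ := isCompact_Icc.exists_bound_of_continuousOn h₁.continuousOn_snd
    obtain ⟨R₃, h3⟩ := isCompact_Icc.exists_bound_of_continuousOn h₂.continuousOn_fst
    obtain ⟨R₄, h4⟩ := isCompact_Icc.exists_bound_of_continuousOn h₂.continuousOn_snd
    refine ⟨max (max R₁ R₂) (max R₃ R₄), fun θ hθ => ⟨?_, ?_, ?_, ?_⟩⟩
    · exact (h1 θ hθ).trans ((le_max_left _ _).trans (le_max_left _ _))
    · exact (h2 θ hθ).trans ((le_max_right _ _).trans (le_max_left _ _))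
    · exact (h3 θ hθ).trans ((le_max_left _ _).trans (le_max_right _ _))
    · exact (h4 θ hθ).trans ((le_max_right _ _).trans (le_max_right _ _))
  obtain ⟨K, hK⟩ := D.lipschitz R
  set v : ℝ → ℝ × ℝ → ℝ × ℝ := fun θ z => (-Hp z.1 θ z.2, Hx z.1 θ z.2) with hv
  have hcX : ContinuousOn (fun θ => (X θ, P θ)) (Icc s t) :=
    h₁.continuousOn_fst.prodMk h₁.continuousOn_snd
  have hcY : ContinuousOn (fun θ => (Y θ, Q θ)) (Icc s t) :=
    h₂.continuousOn_fst.prodMk h₂.continuousOn_snd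
  have hdX : ∀ θ ∈ Icc s t, HasDerivAt (fun θ => (X θ, P θ)) (v θ (X θ, P θ)) θ :=
    fun θ hθ => (h₁.hasDerivAt_fst θ hθ).prodMk (h₁.hasDerivAt_snd θ hθ)
  have hdY : ∀ θ ∈ Icc s t, HasDerivAt (fun θ => (Y θ, Q θ)) (v θ (Y θ, Q θ)) θ :=
    fun θ hθ => (h₂.hasDerivAt_fst θ hθ).prodMk (h₂.hasDerivAt_snd θ hθ)
  have hmX : ∀ θ ∈ Icc s t, (X θ, P θ) ∈ Icc (-R) R ×ˢ Icc (-R) R :=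
    fun θ hθ => ⟨abs_le.1 (hR θ hθ).1, abs_le.1 (hR θ hθ).2.1⟩
  have hmY : ∀ θ ∈ Icc s t, (Y θ, Q θ) ∈ Icc (-R) R ×ˢ Icc (-R) R :=
    fun θ hθ => ⟨abs_le.1 (hR θ hθ).2.2.1, abs_le.1 (hR θ hθ).2.2.2⟩
  have heq : (X τ, P τ) = (Y τ, Q τ) := by rw [hX, hP]
  have hl : Icc s τ ⊆ Icc s t := Icc_subset_Icc_right hτ.2
  have hr : Icc τ t ⊆ Icc s t := Icc_subset_Icc_left hτ.1
  have hleft := ODE_solution_unique_of_mem_Icc_left (v := v) (K := K) (fun θ _ => hK θ)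
    (hcX.mono hl) (fun θ hθ => (hdX θ (hl (Ioc_subset_Icc_self hθ))).hasDerivWithinAt)
    (fun θ hθ => hmX θ (hl (Ioc_subset_Icc_self hθ)))
    (hcY.mono hl) (fun θ hθ => (hdY θ (hl (Ioc_subset_Icc_self hθ))).hasDerivWithinAt)
    (fun θ hθ => hmY θ (hl (Ioc_subset_Icc_self hθ))) heq
  have hright := ODE_solution_unique_of_mem_Icc_right (v := v) (K := K) (fun θ _ => hK θ)
    (hcX.mono hr) (fun θ hθ => (hdX θ (hr (Ico_subset_Icc_self hθ))).hasDerivWithinAt)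
    (fun θ hθ => hmX θ (hr (Ico_subset_Icc_self hθ)))
    (hcY.mono hr) (fun θ hθ => (hdY θ (hr (Ico_subset_Icc_self hθ))).hasDerivWithinAt)
    (fun θ hθ => hmY θ (hr (Ico_subset_Icc_self hθ))) heq
  intro θ hθ
  rcases le_total θ τ with h | h
  · exact congrArg Prod.fst (hleft ⟨hθ.1, h⟩)
  · exact congrArg Prod.fst (hright ⟨h, hθ.2⟩)

/-- Two solutions whose paths agree on a nontrivial subinterval have the same path. -/
lemma eqOn_of_eqOn_subinterval (h₁ : IsHamiltonianArc Lv Hx Hp s t X P)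
    (h₂ : IsHamiltonianArc Lv Hx Hp s t Y Q) {a b : ℝ} (hab : a < b) (ha : s ≤ a) (hb : b ≤ t)
    (h : EqOn X Y (Icc a b)) : EqOn X Y (Icc s t) := by
  obtain ⟨τ, haτ, hτb⟩ := exists_between hab
  have hτ : τ ∈ Icc s t := ⟨ha.trans haτ.le, hτb.le.trans hb⟩
  have hX : X τ = Y τ := h ⟨haτ.le, hτb.le⟩
  have hev : X =ᶠ[𝓝 τ] Y := by
    filter_upwards [Icc_mem_nhds haτ hτb] with θ hθ using h hθ
  -- At an interior time of the subinterval the velocities agree, and position and velocity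
  -- determine the momentum.
  have hd := (h₁.hasDerivAt_fst τ hτ).unique
    ((h₂.hasDerivAt_fst τ hτ).congr_of_eventuallyEq hev)
  refine D.eqOn_of_eq_at h₁ h₂ hτ hX ?_
  rw [h₁.momentum τ hτ, h₂.momentum τ hτ, hd, hX]

lemma arc_isAdmissiblePath (hst : s < t) (hu : IsOptimalVelocity L s t y x u)
    (h : IsHamiltonianArc Lv Hx Hp s t X P) (hX : ∀ θ ∈ Icc s t, X θ = pathOf s y u θ) :
    IsAdmissiblePath s y t x X := by
  have := D.isAdmissiblePath_of_arc hst h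
  rwa [hX s (left_mem_Icc.2 hst.le), hX t (right_mem_Icc.2 hst.le), pathOf_left,
    hu.pathOf_right] at this

omit D in
lemma arc_action_eq (hst : s < t) (h : IsHamiltonianArc Lv Hx Hp s t X P)
    (hX : ∀ θ ∈ Icc s t, X θ = pathOf s y u θ)
    (hae : ∀ᵐ θ ∂(volume.restrict (Ioc s t)), u θ = -Hp (X θ) θ (P θ)) :
    action L s t X = velAction L s t y u := by
  rw [action, velAction, intervalIntegral.integral_of_le hst.le,
    intervalIntegral.integral_of_le hst.le]
  refine integral_congr_ae ?_
  filter_upwards [hae, ae_restrict_mem measurableSet_Ioc] with θ h1 hθ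
  have hθ' := Ioc_subset_Icc_self hθ
  rw [h.velocity_eq hst hθ', ← h1, hX θ hθ']

/-- Enlarging the class of competitors to L² velocities does not raise the supremum: the L²
maximizer is itself represented by a C¹ path, and every C¹ path has an L² velocity. -/
theorem fundW_eq (hst : s < t) (hu : IsOptimalVelocity L s t y x u) :
    fundW L x t y s = velAction L s t y u := by
  obtain ⟨X, P, harc, hX, hae⟩ := D.exists_isHamiltonianArc hst hu
  refine IsGreatest.csSup_eq ⟨⟨X, D.arc_isAdmissiblePath hst hu harc hX,
    (arc_action_eq hst harc hX hae).symm⟩, ?_⟩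
  rintro _ ⟨ξ, hξ, rfl⟩
  rw [hξ.action_eq hst]
  exact hu.le_action _ (hξ.isVelocity hst)

theorem exists_isMaximizingPath (hst : s < t) (y x : ℝ) :
    ∃ ξ, IsMaximizingPath L s y t x ξ := by
  obtain ⟨u, hu⟩ := D.exists_isOptimalVelocity hst y x
  obtain ⟨X, P, harc, hX, hae⟩ := D.exists_isHamiltonianArc hst hu
  exact ⟨X, D.arc_isAdmissiblePath hst hu harc hX,
    (arc_action_eq hst harc hX hae).trans (D.fundW_eq hst hu).symm⟩

/-- Makes regularity and noncrossing, proved for L² optima, available for an arbitrary maximizing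
path. -/
theorem isOptimalVelocity_velocity (hst : s < t) (h : IsMaximizingPath L s y t x ξ) :
    IsOptimalVelocity L s t y x (velocity s t ξ) where
  toIsVelocity := h.1.isVelocity hst
  le_action w hw := by
    obtain ⟨u, hu⟩ := D.exists_isOptimalVelocity hst y x
    rw [← h.1.action_eq hst, h.2, D.fundW_eq hst hu]
    exact hu.le_action w hw

end IsTonelli

/-! ### Splicing and noncrossing -/

/-- The velocity that equals `a` up to time `τ` and `b` afterwards. -/
noncomputable def splice (τ : ℝ) (a b : ℝ → ℝ) (r : ℝ) : ℝ :=
  indicator (Iic τ) a r + indicator (Ioi τ) b r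

section Splice

variable {s t τ y x y' x' : ℝ} {a b : ℝ → ℝ}

lemma splice_of_le {r : ℝ} (h : r ≤ τ) : splice τ a b r = a r := by
  simp [splice, h]

lemma splice_of_lt {r : ℝ} (h : τ < r) : splice τ a b r = b r := by
  simp [splice, h]

lemma memLp_splice (ha : MemLp a 2 (volume.restrict (Ioc s t)))
    (hb : MemLp b 2 (volume.restrict (Ioc s t))) :
    MemLp (splice τ a b) 2 (volume.restrict (Ioc s t)) :=
  (ha.indicator measurableSet_Iic).add (hb.indicator measurableSet_Ioi)

lemma pathOf_splice_left {θ : ℝ} (hθ : s ≤ θ) (hθτ : θ ≤ τ) :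
    pathOf s y (splice τ a b) θ = pathOf s y a θ := by
  simp only [pathOf, intervalIntegral.integral_of_le hθ]
  congr 1
  exact setIntegral_congr_fun measurableSet_Ioc fun r hr => splice_of_le (hr.2.trans hθτ)

lemma pathOf_eq_add {u : ℝ → ℝ} (hst : s ≤ t) (hu : MemLp u 2 (volume.restrict (Ioc s t)))
    (hτ : τ ∈ Icc s t) {θ : ℝ} (hθ : θ ∈ Icc s t) :
    pathOf s y u θ = pathOf s y u τ + ∫ r in τ..θ, u r := by
  have hi := intervalIntegrable_of_memLp hst hu
  have hsub : ∀ {p q : ℝ}, p ∈ Icc s t → q ∈ Icc s t → IntervalIntegrable u volume p q :=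
    fun hp hq => hi.mono_set (by rw [uIcc_of_le hst]; exact uIcc_subset_Icc hp hq)
  have hs : s ∈ Icc s t := left_mem_Icc.2 hst
  rw [pathOf, pathOf, ← intervalIntegral.integral_add_adjacent_intervals (hsub hs hτ)
    (hsub hτ hθ)]
  ring

lemma pathOf_splice_right (hst : s ≤ t) (ha : MemLp a 2 (volume.restrict (Ioc s t)))
    (hb : MemLp b 2 (volume.restrict (Ioc s t))) (hτ : τ ∈ Icc s t)
    (hmeet : pathOf s y a τ = pathOf s y' b τ) {θ : ℝ} (hθ : θ ∈ Icc s t) (hτθ : τ ≤ θ) :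
    pathOf s y (splice τ a b) θ = pathOf s y' b θ := by
  rw [pathOf_eq_add hst (memLp_splice ha hb) hτ hθ, pathOf_eq_add hst hb hτ hθ, ← hmeet,
    pathOf_splice_left hτ.1 le_rfl, intervalIntegral.integral_of_le hτθ,
    intervalIntegral.integral_of_le hτθ]
  congr 1
  exact setIntegral_congr_fun measurableSet_Ioc fun r hr => splice_of_lt hr.1

lemma IsVelocity.splice (hst : s ≤ t) (ha : IsVelocity s t y x a) (hb : IsVelocity s t y' x' b)
    (hτ : τ ∈ Icc s t) (hmeet : pathOf s y a τ = pathOf s y' b τ) :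
    IsVelocity s t y x' (splice τ a b) where
  memLp := memLp_splice ha.memLp hb.memLp
  integral_eq := by
    have h := pathOf_splice_right hst ha.memLp hb.memLp hτ hmeet (right_mem_Icc.2 hst) hτ.2
    rw [hb.pathOf_right, pathOf] at h
    linarith

end Splice

/-- The part of the action of a path that is due to the time interval `[p, q]`. -/
noncomputable def partialAction (L : PhaseFun) (s y p q : ℝ) (u : ℝ → ℝ) : ℝ :=
  ∫ θ in p..q, L (pathOf s y u θ) θ (u θ)

namespace IsTonelli

variable {L Lx Lv Hx Hp : PhaseFun} {c₀ c₁ c₂ : ℝ} (D : IsTonelli L Lx Lv Hx Hp c₀ c₁ c₂)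
variable {s t τ y x y₁ y₂ x₁ x₂ : ℝ} {u a b u₁ u₂ X P X₁ P₁ X₂ P₂ ξ : ℝ → ℝ}
include D

lemma partialAction_add (hst : s ≤ t) (hu : MemLp u 2 (volume.restrict (Ioc s t)))
    (hτ : τ ∈ Icc s t) :
    partialAction L s y s τ u + partialAction L s y τ t u = velAction L s t y u := by
  have hi : IntervalIntegrable (fun θ => L (pathOf s y u θ) θ (u θ)) volume s t :=
    (intervalIntegrable_iff_integrableOn_Ioc_of_le hst).2
      (D.integrable_L (aestronglyMeasurable_of_continuousOn_Icc
        (continuousOn_pathOf hst (intervalIntegrable_of_memLp hst hu))) hu)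
  refine intervalIntegral.integral_add_adjacent_intervals (hi.mono_set ?_) (hi.mono_set ?_) <;>
    rw [uIcc_of_le hst]
  · exact uIcc_subset_Icc (left_mem_Icc.2 hst) hτ
  · exact uIcc_subset_Icc hτ (right_mem_Icc.2 hst)

lemma velAction_splice (hst : s ≤ t) (ha : MemLp a 2 (volume.restrict (Ioc s t)))
    (hb : MemLp b 2 (volume.restrict (Ioc s t))) (hτ : τ ∈ Icc s t)
    (hmeet : pathOf s y₁ a τ = pathOf s y₂ b τ) :
    velAction L s t y₁ (splice τ a b) =
      partialAction L s y₁ s τ a + partialAction L s y₂ τ t b := by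
  rw [← D.partialAction_add hst (memLp_splice ha hb) hτ]
  simp only [partialAction, intervalIntegral.integral_of_le hτ.1,
    intervalIntegral.integral_of_le hτ.2]
  congr 1
  · refine setIntegral_congr_fun measurableSet_Ioc fun θ hθ => ?_
    simp only [pathOf_splice_left hθ.1.le hθ.2, splice_of_le hθ.2]
  · refine setIntegral_congr_fun measurableSet_Ioc fun θ hθ => ?_
    simp only [pathOf_splice_right hst ha hb hτ hmeet ⟨hτ.1.trans hθ.1.le, hθ.2⟩ hθ.1.le,
      splice_of_lt hθ.1]

/-- If two optimal paths with a common end point meet at an intermediate time, then switching from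
one to the other gives an optimal path. -/
lemma isOptimalVelocity_splice (hst : s ≤ t) (h₁ : IsOptimalVelocity L s t y₁ x₁ u₁)
    (h₂ : IsOptimalVelocity L s t y₂ x₂ u₂) (hτ : τ ∈ Icc s t)
    (hmeet : pathOf s y₁ u₁ τ = pathOf s y₂ u₂ τ) (hend : y₁ = y₂ ∨ x₁ = x₂) :
    IsOptimalVelocity L s t y₂ x₁ (splice τ u₂ u₁) := by
  have v₁₂ := h₁.toIsVelocity.splice hst h₂.toIsVelocity hτ hmeet
  have v₂₁ := h₂.toIsVelocity.splice hst h₁.toIsVelocity hτ hmeet.symm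
  have e₁ := D.partialAction_add (y := y₁) hst h₁.memLp hτ
  have e₂ := D.partialAction_add (y := y₂) hst h₂.memLp hτ
  have e₁₂ := D.velAction_splice hst h₁.memLp h₂.memLp hτ hmeet
  have e₂₁ := D.velAction_splice hst h₂.memLp h₁.memLp hτ hmeet.symm
  refine ⟨v₂₁, fun w hw => ?_⟩
  -- The two spliced actions add up to the two original ones. With a common end point each splice
  -- competes with one original, so a loss in one would be a gain in the other.
  rcases hend with rfl | rfl
  · have i₁ := h₁.le_action w hw
    have i₂ := h₂.le_action _ v₁₂
    linarith
  · have i₁ := h₂.le_action w hw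
    have i₂ := h₁.le_action _ v₁₂
    linarith

/-- Two optimal paths with a common end point that meet at an intermediate time coincide. -/
theorem eqOn_of_meet (hst : s < t) (h₁ : IsOptimalVelocity L s t y₁ x₁ u₁)
    (h₂ : IsOptimalVelocity L s t y₂ x₂ u₂) (hτ : τ ∈ Ioo s t)
    (hmeet : pathOf s y₁ u₁ τ = pathOf s y₂ u₂ τ) (hend : y₁ = y₂ ∨ x₁ = x₂) :
    EqOn (pathOf s y₁ u₁) (pathOf s y₂ u₂) (Icc s t) := by
  have hτ' := Ioo_subset_Icc_self hτ
  obtain ⟨X₁, P₁, a₁, e₁, -⟩ := D.exists_isHamiltonianArc hst h₁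
  obtain ⟨X₂, P₂, a₂, e₂, -⟩ := D.exists_isHamiltonianArc hst h₂
  -- The spliced path is optimal, hence a Hamiltonian arc with no corner at `τ`; it follows the
  -- second path before `τ` and the first one after.
  obtain ⟨X, P, a, e, -⟩ := D.exists_isHamiltonianArc hst
    (D.isOptimalVelocity_splice hst.le h₁ h₂ hτ' hmeet hend)
  have k₂ : EqOn X X₂ (Icc s t) := D.eqOn_of_eqOn_subinterval a a₂ hτ.1 le_rfl hτ.2.le
    fun θ hθ => by
      have hθ' : θ ∈ Icc s t := ⟨hθ.1, hθ.2.trans hτ.2.le⟩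
      rw [e θ hθ', e₂ θ hθ', pathOf_splice_left hθ.1 hθ.2]
  have k₁ : EqOn X X₁ (Icc s t) := D.eqOn_of_eqOn_subinterval a a₁ hτ.2 hτ.1.le le_rfl
    fun θ hθ => by
      have hθ' : θ ∈ Icc s t := ⟨hτ.1.le.trans hθ.1, hθ.2⟩
      rw [e θ hθ', e₁ θ hθ',
        pathOf_splice_right hst.le h₂.memLp h₁.memLp hτ' hmeet.symm hθ' hθ.1]
  intro θ hθ
  rw [← e₁ θ hθ, ← e₂ θ hθ, ← k₁ hθ, ← k₂ hθ]

/-- Optimal paths with the same initial point do not cross. -/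
theorem pathOf_lt_of_right_lt (hst : s < t) (h₁ : IsOptimalVelocity L s t y x₁ u₁)
    (h₂ : IsOptimalVelocity L s t y x₂ u₂) (hx : x₁ < x₂) {θ : ℝ} (hθ : θ ∈ Ioc s t) :
    pathOf s y u₁ θ < pathOf s y u₂ θ := by
  by_contra! hle
  have hc : ContinuousOn (fun r => pathOf s y u₂ r - pathOf s y u₁ r) (Icc θ t) :=
    ((continuousOn_pathOf hst.le (intervalIntegrable_of_memLp hst.le h₂.memLp)).sub
      (continuousOn_pathOf hst.le (intervalIntegrable_of_memLp hst.le h₁.memLp))).mono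
      (Icc_subset_Icc_left hθ.1.le)
  have ht : pathOf s y u₁ t < pathOf s y u₂ t := by rwa [h₁.pathOf_right, h₂.pathOf_right]
  obtain ⟨τ, hτ, hτ0⟩ := intermediate_value_Icc hθ.2 hc
    (show (0 : ℝ) ∈ Icc _ _ from ⟨sub_nonpos.2 hle, (sub_pos.2 ht).le⟩)
  have hτt : τ < t := lt_of_le_of_ne hτ.2 (by rintro rfl; simp only at hτ0; linarith)
  have := D.eqOn_of_meet hst h₁ h₂ ⟨hθ.1.trans_le hτ.1, hτt⟩ (sub_eq_zero.1 hτ0).symm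
    (Or.inl rfl) (right_mem_Icc.2 hst.le)
  exact ht.ne this

/-- Optimal paths with the same final point do not cross. -/
theorem pathOf_lt_of_left_lt (hst : s < t) (h₁ : IsOptimalVelocity L s t y₁ x u₁)
    (h₂ : IsOptimalVelocity L s t y₂ x u₂) (hy : y₁ < y₂) {θ : ℝ} (hθ : θ ∈ Ico s t) :
    pathOf s y₁ u₁ θ < pathOf s y₂ u₂ θ := by
  by_contra! hle
  have hc : ContinuousOn (fun r => pathOf s y₁ u₁ r - pathOf s y₂ u₂ r) (Icc s θ) :=
    ((continuousOn_pathOf hst.le (intervalIntegrable_of_memLp hst.le h₁.memLp)).sub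
      (continuousOn_pathOf hst.le (intervalIntegrable_of_memLp hst.le h₂.memLp))).mono
      (Icc_subset_Icc_right hθ.2.le)
  have hs : pathOf s y₁ u₁ s < pathOf s y₂ u₂ s := by rwa [pathOf_left, pathOf_left]
  obtain ⟨τ, hτ, hτ0⟩ := intermediate_value_Icc hθ.1 hc
    (show (0 : ℝ) ∈ Icc _ _ from ⟨(sub_neg.2 hs).le, sub_nonneg.2 hle⟩)
  have hsτ : s < τ := lt_of_le_of_ne hτ.1 (by rintro rfl; simp only at hτ0; linarith)
  have := D.eqOn_of_meet hst h₁ h₂ ⟨hsτ, hτ.2.trans_lt hθ.2⟩ (sub_eq_zero.1 hτ0)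
    (Or.inr rfl) (left_mem_Icc.2 hst.le)
  exact hs.ne this

/-! ### Values of `M` as final momenta -/

/-- Where `W` is differentiable in the end point, its derivative is the final momentum of every
optimal path. -/
theorem deriv_fundW_eq (hst : s < t) (hu : IsOptimalVelocity L s t y x u)
    (h : IsHamiltonianArc Lv Hx Hp s t X P) (hX : ∀ θ ∈ Icc s t, X θ = pathOf s y u θ)
    (hae : ∀ᵐ θ ∂(volume.restrict (Ioc s t)), u θ = -Hp (X θ) θ (P θ)) {p : ℝ}
    (hp : HasDerivAt (fun x' => fundW L x' t y s) p x) : p = P t := by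
  have hts : t - s ≠ 0 := (sub_pos.2 hst).ne'
  -- A constant velocity perturbation that fixes the initial point and moves the final point at unit
  -- rate.
  set w : ℝ → ℝ := fun _ => 1 / (t - s) with hw
  have hwL : MemLp w 2 (volume.restrict (Ioc s t)) := memLp_const _
  have hw1 : ∫ θ in s..t, w θ = 1 := by
    simp only [hw, intervalIntegral.integral_const, smul_eq_mul]
    exact mul_div_cancel₀ _ hts
  have hη : ∀ θ, HasDerivAt (pathOf s 0 w) (w θ) θ := hasDerivAt_pathOf continuous_const
  have hφ := D.hasDerivAt_velAction (y := y) hst.le hu.memLp hwL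
  have hval : ∫ θ in s..t, (Lx (pathOf s y u θ) θ (u θ) * pathOf s 0 w θ
      + Lv (pathOf s y u θ) θ (u θ) * w θ) = P t := by
    have hcont : ContinuousOn (fun θ => Hx (X θ) θ (P θ) * pathOf s 0 w θ + P θ * w θ)
        (Icc s t) := by
      have h1 : ContinuousOn (fun θ => Hx (X θ) θ (P θ)) (Icc s t) :=
        D.continuous_Hx.comp_continuousOn
          (h.continuousOn_fst.prodMk (continuousOn_id.prodMk h.continuousOn_snd))
      have h2 : ContinuousOn (pathOf s 0 w) (Icc s t) :=
        fun θ _ => (hη θ).continuousAt.continuousWithinAt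
      exact (h1.mul h2).add (h.continuousOn_snd.mul continuousOn_const)
    -- By the Hamiltonian system the integrand is the derivative of `P` times the perturbation, so
    -- only the boundary term at `t` survives.
    have hftc : ∫ θ in s..t, (Hx (X θ) θ (P θ) * pathOf s 0 w θ + P θ * w θ)
        = P t * pathOf s 0 w t - P s * pathOf s 0 w s := by
      refine intervalIntegral.integral_eq_sub_of_hasDerivAt
        (f := fun θ => P θ * pathOf s 0 w θ) (fun θ hθ => ?_)
        (ContinuousOn.intervalIntegrable (by rwa [uIcc_of_le hst.le]))
      rw [uIcc_of_le hst.le] at hθ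
      exact (h.hasDerivAt_snd θ hθ).mul (hη θ)
    have h1 : pathOf s 0 w t = 1 := by rw [pathOf, hw1, zero_add]
    rw [h1, pathOf_left, mul_one, mul_zero, sub_zero] at hftc
    rw [← hftc, intervalIntegral.integral_of_le hst.le, intervalIntegral.integral_of_le hst.le]
    refine integral_congr_ae ?_
    filter_upwards [hae, ae_restrict_mem measurableSet_Ioc] with θ h1 hθ
    have hθ' := Ioc_subset_Icc_self hθ
    have h2 : P θ = Lv (pathOf s y u θ) θ (u θ) := by
      rw [h1, ← hX θ hθ', ← h.momentum θ hθ']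
    have h3 : Hx (X θ) θ (P θ) = Lx (pathOf s y u θ) θ (u θ) := by
      rw [h2, hX θ hθ', D.Hx_Lv]
    rw [h3, ← h2]
  rw [hval] at hφ
  have hW : HasDerivAt (fun ε => fundW L (x + ε) t y s) p 0 := by
    have hp' : HasDerivAt (fun x' => fundW L x' t y s) p (x + 0) := by simpa using hp
    exact hp'.comp_const_add x 0
  -- Envelope argument: the perturbed path competes for `W` at the shifted end point, with equality
  -- at `ε = 0`.
  have hmin : IsLocalMin (fun ε => fundW L (x + ε) t y s
      - velAction L s t y (fun r => u r + ε * w r)) 0 := by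
    refine Eventually.of_forall fun ε => ?_
    obtain ⟨v, hv⟩ := D.exists_isOptimalVelocity hst y (x + ε)
    have h1 := hv.le_action _ (by simpa using hu.toIsVelocity.add_mul hst.le hwL hw1 ε)
    simp only [add_zero, zero_mul]
    rw [D.fundW_eq hst hv, D.fundW_eq hst hu]
    linarith
  have := hmin.hasDerivAt_eq_zero (hW.sub hφ)
  linarith

/-- Every value of `M` is the final momentum of an optimal path. -/
theorem exists_arc_of_mem_fundM (hst : s < t) (hLv : ∀ v, partialV L x t v = Lv x t v) {p : ℝ}
    (hp : p ∈ fundM L x t y s) :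
    ∃ u X P, IsOptimalVelocity L s t y x u ∧ IsHamiltonianArc Lv Hx Hp s t X P ∧
      (∀ θ ∈ Icc s t, X θ = pathOf s y u θ) ∧ p = P t := by
  rcases hp with hp | ⟨ξ, hξ, rfl⟩
  · obtain ⟨u, hu⟩ := D.exists_isOptimalVelocity hst y x
    obtain ⟨X, P, harc, hX, hae⟩ := D.exists_isHamiltonianArc hst hu
    exact ⟨u, X, P, hu, harc, hX, D.deriv_fundW_eq hst hu harc hX hae hp⟩
  · have hu := D.isOptimalVelocity_velocity hst hξ
    obtain ⟨X, P, harc, hX, hae⟩ := D.exists_isHamiltonianArc hst hu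
    have ht := right_mem_Icc.2 hst.le
    have heq : EqOn ξ X (Icc s t) := fun θ hθ => by rw [hX θ hθ, hξ.1.pathOf_velocity hst hθ]
    refine ⟨_, X, P, hu, harc, hX, ?_⟩
    rw [harc.momentum_eq hst ht, hLv, velocity_congr heq ht, ← heq ht, hξ.1.right_eq]

/-- Before time `t` the first path lies below the second, so left difference quotients order the
final velocities the opposite way, and the decreasing `L_v` orders the momenta. Equal momenta at the
common end point would, by uniqueness, give equal initial points. -/
theorem fundM_strictMono (hst : s < t) (hLv : ∀ v, partialV L x t v = Lv x t v) (hy : y₁ < y₂)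
    {p₁ p₂ : ℝ} (hp₁ : p₁ ∈ fundM L x t y₁ s) (hp₂ : p₂ ∈ fundM L x t y₂ s) : p₁ < p₂ := by
  obtain ⟨u₁, X₁, P₁, h₁, a₁, e₁, rfl⟩ := D.exists_arc_of_mem_fundM hst hLv hp₁
  obtain ⟨u₂, X₂, P₂, h₂, a₂, e₂, rfl⟩ := D.exists_arc_of_mem_fundM hst hLv hp₂
  have ht := right_mem_Icc.2 hst.le
  have hs := left_mem_Icc.2 hst.le
  have hX : X₁ t = X₂ t := by rw [e₁ t ht, e₂ t ht, h₁.pathOf_right, h₂.pathOf_right]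
  have hd := (a₂.hasDerivAt_fst t ht).sub (a₁.hasDerivAt_fst t ht)
  have hle : -Hp (X₂ t) t (P₂ t) - -Hp (X₁ t) t (P₁ t) ≤ 0 := by
    refine le_of_tendsto (hasDerivAt_iff_tendsto_slope_left_right.1 hd).1 ?_
    filter_upwards [Ioo_mem_nhdsLT hst] with θ hθ
    have hθ' := Ioo_subset_Icc_self hθ
    have hlt := D.pathOf_lt_of_left_lt hst h₁ h₂ hy (Ioo_subset_Ico_self hθ)
    rw [← e₁ θ hθ', ← e₂ θ hθ'] at hlt
    rw [slope_def_field]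
    refine div_nonpos_of_nonneg_of_nonpos ?_ (sub_nonpos.2 hθ.2.le)
    simp only [Pi.sub_apply]
    linarith
  have hP : P₁ t ≤ P₂ t := by
    rw [a₁.momentum t ht, a₂.momentum t ht, ← hX]
    refine (D.strictAnti _ t).antitone ?_
    rw [← hX] at hle
    linarith
  refine lt_of_le_of_ne hP fun heq => hy.ne ?_
  have := D.eqOn_of_eq_at a₁ a₂ ht hX heq hs
  rwa [e₁ s hs, e₂ s hs, pathOf_left, pathOf_left] at this

/-! ### Sign and size of the final momentum -/

lemma Lv_mul_le (x t v : ℝ) : Lv x t v * v ≤ 2 * c₀ - c₂ * v ^ 2 := by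
  -- The tangent line at `v`, evaluated at velocity 0, combined with the growth bounds.
  have h1 := D.tangent x t v 0
  have h2 := D.upper x t v
  have h3 := D.lower x t 0
  simp only [ne_eq, OfNat.ofNat_ne_zero, not_false_eq_true, zero_pow, mul_zero] at h3
  linarith

/-- The momentum of an arc varies at most at the rate `c₁`, and at some time it is the momentum of
the mean velocity. -/
lemma exists_abs_momentum_sub_le (hst : s < t) (h : IsHamiltonianArc Lv Hx Hp s t X P) :
    ∃ z τ, |P t - Lv z τ ((X t - X s) / (t - s))| ≤ c₁ * (t - s) := by
  obtain ⟨τ, hτ, hv⟩ := exists_hasDerivAt_eq_slope X (fun θ => -Hp (X θ) θ (P θ)) hst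
    h.continuousOn_fst fun θ hθ => h.hasDerivAt_fst θ (Ioo_subset_Icc_self hθ)
  have hτ' := Ioo_subset_Icc_self hτ
  refine ⟨X τ, τ, ?_⟩
  rw [← hv, ← h.momentum τ hτ']
  have hb : ∀ θ ∈ Icc s t, ‖Hx (X θ) θ (P θ)‖ ≤ c₁ := fun θ hθ => by
    rw [h.momentum θ hθ, D.Hx_Lv]
    exact D.abs_Lx_le _ _ _
  have := (convex_Icc s t).norm_image_sub_le_of_norm_hasDerivWithin_le
    (fun θ hθ => (h.hasDerivAt_snd θ hθ).hasDerivWithinAt) hb hτ' (right_mem_Icc.2 hst.le)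
  refine this.trans (mul_le_mul_of_nonneg_left ?_ D.c₁_pos.le)
  rw [Real.norm_eq_abs, abs_of_nonneg (sub_nonneg.2 hτ.2.le)]
  linarith [hτ.1]

lemma momentum_le (hst : s < t) (h : IsHamiltonianArc Lv Hx Hp s t X P) {k : ℝ} (hk : 1 ≤ k)
    (hX : k * (t - s) ≤ X t - X s) : P t ≤ 2 * c₀ - c₂ * k + c₁ * (t - s) := by
  obtain ⟨z, τ, hz⟩ := D.exists_abs_momentum_sub_le hst h
  set v := (X t - X s) / (t - s) with hv
  have hkv : k ≤ v := (le_div_iff₀ (sub_pos.2 hst)).2 hX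
  have h1 := D.Lv_mul_le z τ v
  -- Division of `Lv_mul_le` by `v`; since `v ≥ k ≥ 1`, the term `2 c₀ / v` is at most `2 c₀`.
  have h2 : Lv z τ v ≤ 2 * c₀ - c₂ * v := by
    by_contra! hlt
    nlinarith [D.c₀_pos, mul_lt_mul_of_pos_right hlt (by linarith : 0 < v)]
  have h3 := mul_le_mul_of_nonneg_left hkv D.c₂_pos.le
  have h4 := (abs_le.1 hz).2
  linarith

lemma le_momentum (hst : s < t) (h : IsHamiltonianArc Lv Hx Hp s t X P) {k : ℝ} (hk : 1 ≤ k)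
    (hX : X t - X s ≤ -(k * (t - s))) : -(2 * c₀ - c₂ * k + c₁ * (t - s)) ≤ P t := by
  obtain ⟨z, τ, hz⟩ := D.exists_abs_momentum_sub_le hst h
  set v := (X t - X s) / (t - s) with hv
  have hkv : v ≤ -k := by
    rw [hv, div_le_iff₀ (sub_pos.2 hst)]
    linarith
  have h1 := D.Lv_mul_le z τ v
  have h2 : -(2 * c₀ + c₂ * v) ≤ Lv z τ v := by
    by_contra! hlt
    nlinarith [D.c₀_pos, mul_lt_mul_of_neg_right hlt (by linarith : v < 0)]
  have h3 := mul_le_mul_of_nonneg_left hkv D.c₂_pos.le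
  have h4 := (abs_le.1 hz).1
  linarith

theorem exists_sign_and_bound {T δ : ℝ} (hsT : s < T) (hδ : 0 < δ) :
    ∃ C₀ C₁ : ℝ, 0 < C₀ ∧ 0 < C₁ ∧ ∀ t ∈ Ioc s T, ∀ x y : ℝ, C₀ ≤ |x| → |y| ≤ (1 - δ) * |x| →
      (∀ v, partialV L x t v = Lv x t v) → ∀ p ∈ fundM L x t y s,
        SignType.sign p = SignType.sign (-x) ∧ C₁ * |x| ≤ |p| := by
  have hTs : 0 < T - s := sub_pos.2 hsT
  set κ := δ / (T - s) with hκ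
  have hκ0 : 0 < κ := div_pos hδ hTs
  have hc₂κ : 0 < c₂ * κ := mul_pos D.c₂_pos hκ0
  set A := 2 * c₀ + c₁ * (T - s) with hA
  have hA0 : 0 < A := by
    have := mul_pos D.c₁_pos hTs
    linarith [D.c₀_pos]
  -- The momentum bounds are used with `k = κ |x|`. The summand `1 / κ` ensures `k ≥ 1`; the other
  -- makes `A` at most half of `c₂ κ |x|`, and the remaining half gives the second constant.
  refine ⟨1 / κ + 2 * A / (c₂ * κ), c₂ * κ / 2, by positivity, by positivity, ?_⟩
  intro t ht x y hx hy hLv p hp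
  obtain ⟨u, X, P, hu, harc, hX, rfl⟩ := D.exists_arc_of_mem_fundM ht.1 hLv hp
  have hXt : X t = x := by rw [hX t (right_mem_Icc.2 ht.1.le), hu.pathOf_right]
  have hXs : X s = y := by rw [hX s (left_mem_Icc.2 ht.1.le), pathOf_left]
  have hpos : 0 < |x| := lt_of_lt_of_le (by positivity) hx
  have h1 : 1 ≤ κ * |x| := by
    have : 1 / κ ≤ |x| := le_trans (le_add_of_nonneg_right (by positivity)) hx
    rwa [div_le_iff₀' hκ0] at this
  have h2 : 2 * A ≤ c₂ * κ * |x| := by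
    have : 2 * A / (c₂ * κ) ≤ |x| := le_trans (le_add_of_nonneg_left (by positivity)) hx
    rwa [div_le_iff₀' hc₂κ] at this
  -- As `|x - y| ≥ δ |x|` and `t - s ≤ T - s`, the mean speed is at least `κ |x|`, uniformly in `t`.
  have h3 : κ * |x| * (t - s) ≤ δ * |x| := by
    have : κ * (t - s) ≤ δ := by
      rw [hκ, div_mul_eq_mul_div, div_le_iff₀ hTs]
      exact mul_le_mul_of_nonneg_left (by linarith [ht.2]) hδ.le
    calc κ * |x| * (t - s) = κ * (t - s) * |x| := by ring
      _ ≤ δ * |x| := mul_le_mul_of_nonneg_right this hpos.le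
  have h4 : c₁ * (t - s) ≤ c₁ * (T - s) :=
    mul_le_mul_of_nonneg_left (by linarith [ht.2]) D.c₁_pos.le
  have hy' := abs_le.1 hy
  rcases lt_or_gt_of_ne (abs_pos.1 hpos) with hx0 | hx0
  · rw [abs_of_neg hx0] at *
    have key := D.le_momentum ht.1 harc h1 (by rw [hXt, hXs]; linarith)
    have hb : c₂ * κ / 2 * -x ≤ P t := by linarith
    have hP : 0 < P t := lt_of_lt_of_le (by positivity) hb
    exact ⟨by rw [sign_pos hP, sign_pos hpos], by rwa [abs_of_pos hP]⟩
  · rw [abs_of_pos hx0] at *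
    have key := D.momentum_le ht.1 harc h1 (by rw [hXt, hXs]; linarith)
    have hb : P t ≤ -(c₂ * κ / 2 * x) := by linarith
    have hP : P t < 0 := lt_of_le_of_lt hb (neg_lt_zero.2 (by positivity))
    exact ⟨by rw [sign_neg hP, sign_neg (neg_lt_zero.2 hx0)],
      by rw [abs_of_neg hP]; linarith⟩

end IsTonelli

/-! ### Independence of the extension in time -/

section ClampTime

variable {L : PhaseFun} {s T t y x : ℝ}

lemma action_clampTime (h : s ≤ T) (ht : t ∈ Ioc s T) (ξ : ℝ → ℝ) :
    action (clampTime L h) s t ξ = action L s t ξ := by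
  refine intervalIntegral.integral_congr fun θ hθ => ?_
  rw [uIcc_of_le ht.1.le] at hθ
  exact clampTime_of_mem L h ⟨hθ.1, hθ.2.trans ht.2⟩

lemma fundW_clampTime (h : s ≤ T) (ht : t ∈ Ioc s T) :
    fundW (clampTime L h) x t y s = fundW L x t y s := by
  simp only [fundW, action_clampTime h ht]

lemma isMaximizingPath_clampTime (h : s ≤ T) (ht : t ∈ Ioc s T) {ξ : ℝ → ℝ} :
    IsMaximizingPath (clampTime L h) s y t x ξ ↔ IsMaximizingPath L s y t x ξ := by
  simp only [IsMaximizingPath, action_clampTime h ht, fundW_clampTime h ht]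

lemma partialV_clampTime (h : s ≤ T) (v : ℝ) :
    partialV (clampTime L h) x t v = clampTime (partialV L) h x t v := rfl

lemma fundM_clampTime (h : s ≤ T) (ht : t ∈ Ioc s T) :
    fundM (clampTime L h) x t y s = fundM L x t y s := by
  simp only [fundM, fundW_clampTime h ht, isMaximizingPath_clampTime h ht, partialV_clampTime,
    clampTime_of_mem (partialV L) h (Ioc_subset_Icc_self ht)]

end ClampTime

end FundSol

theorem proposition5p2 (L H : FundSol.PhaseFun) (s T c₀ c₁ c₂ : ℝ) (hsT : s < T)
    (hyp : FundSol.StandingHypothesis L H s T c₀ c₁ c₂) :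
    -- maximizing paths exist, so that `M` has at least one value at every point
    (∀ x y : ℝ, ∀ t ∈ Set.Ioc s T, ∃ ξ : ℝ → ℝ, FundSol.IsMaximizingPath L s y t x ξ) ∧
    -- (i)
    (∀ y : ℝ, ∀ t ∈ Set.Ioc s T, ∀ x₁ x₂ : ℝ, x₁ < x₂ → ∀ ξ₁ ξ₂ : ℝ → ℝ,
      FundSol.IsMaximizingPath L s y t x₁ ξ₁ → FundSol.IsMaximizingPath L s y t x₂ ξ₂ →
      ∀ θ ∈ Set.Ioc s t, ξ₁ θ < ξ₂ θ) ∧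
    -- (ii)
    (∀ x : ℝ, ∀ t ∈ Set.Ioc s T, ∀ y₁ y₂ : ℝ, y₁ < y₂ →
      ∀ p₁ ∈ FundSol.fundM L x t y₁ s, ∀ p₂ ∈ FundSol.fundM L x t y₂ s, p₁ < p₂) ∧
    -- (iii)
    (∀ δ ∈ Set.Ioo (0 : ℝ) 1, ∃ C₀ C₁ : ℝ, 0 < C₀ ∧ 0 < C₁ ∧
      ∀ t ∈ Set.Ioc s T, ∀ x y : ℝ, C₀ ≤ |x| → |y| ≤ (1 - δ) * |x| →
        ∀ p ∈ FundSol.fundM L x t y s,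
          SignType.sign p = SignType.sign (-x) ∧ C₁ * |x| ≤ |p|) := by
  have D := hyp.isTonelli hsT
  refine ⟨fun x y t ht => ?_, fun y t ht x₁ x₂ hx ξ₁ ξ₂ h₁ h₂ θ hθ => ?_,
    fun x t ht y₁ y₂ hy p₁ hp₁ p₂ hp₂ => ?_, fun δ hδ => ?_⟩
  · obtain ⟨ξ, hξ⟩ := D.exists_isMaximizingPath ht.1 y x
    exact ⟨ξ, (FundSol.isMaximizingPath_clampTime hsT.le ht).1 hξ⟩
  · have hθ' := Ioc_subset_Icc_self hθ
    rw [← h₁.1.pathOf_velocity ht.1 hθ', ← h₂.1.pathOf_velocity ht.1 hθ']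
    rw [← FundSol.isMaximizingPath_clampTime hsT.le ht] at h₁ h₂
    exact D.pathOf_lt_of_right_lt ht.1 (D.isOptimalVelocity_velocity ht.1 h₁)
      (D.isOptimalVelocity_velocity ht.1 h₂) hx hθ
  · rw [← FundSol.fundM_clampTime hsT.le ht] at hp₁ hp₂
    exact D.fundM_strictMono ht.1 (fun _ => rfl) hy hp₁ hp₂
  · obtain ⟨C₀, C₁, h₀, h₁, h⟩ := D.exists_sign_and_bound hsT hδ.1
    refine ⟨C₀, C₁, h₀, h₁, fun t ht x y hx hy p hp => ?_⟩
    rw [← FundSol.fundM_clampTime hsT.le ht] at hp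
    exact h t ht x y hx hy (fun _ => rfl) p hp
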